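/- Let $0<d<\pi/2$, $\mathscr{D}_d=\{\zeta\in\mathbb{C}:|\operatorname{Im}\zeta|<d\}$, and $\psi(\zeta)=\exp\left(\frac{\pi}{2}\sinh\zeta\right)$, with image $\psi(\mathscr{D}_d)=\{\psi(\zeta):\zeta\in\mathscr{D}_d\}\subset\mathbb{C}$. Assume that $f$ is analytic in $\psi(\mathscr{D}_d)$ and that there are positive constants $K,\alpha,\beta$ such that $$|f(z)|\le K\,\left|\frac{z^{\alpha-1}}{(1+z^2)^{(\alpha+\beta)/2}}\right|\qquad\text{for all } z\in\psi(\mathscr{D}_d).$$ Let $\mu=\min\{\alpha,\beta\}$, $\nu=\max\{\alpha,\beta\}$. For a natural number $n$ let $h=\log(8dn/\mu)/n$, and let $$\begin{cases}M=n,\quad N=n-\lfloor\log(\beta/\alpha)/h\rfloor&(\text{if }\mu=\alpha),\\ N=n,\quad M=n-\lfloor\log(\alpha/\beta)/h\rfloor&(\text{if }\mu=\beta).\end{cases}$$ For $\gamma>0$ put $$x_\gamma=\begin{cases}\operatorname{arcsinh}\left(\dfrac{\sqrt{1+\sqrt{1-(2\pi\gamma)^2}}}{2\pi\gamma}\right)&(0<\gamma<1/(2\pi)),\\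 \operatorname{arcsinh}(1)&(1/(2\pi)\le\gamma).\end{cases}$$ Let $n$ be sufficiently large that $n\ge \nu e/(8d)$, $Mh\ge x_{\alpha/2}$ and $Nh\ge x_{\beta/2}$. Then $f$ is integrable on $(0,\infty)$ and $$\left|\int_0^\infty f(t)\,dt-h\sum_{k=-M}^{N}f(\psi(kh))\,\psi'(kh)\right|\le C_2\,e^{-2\pi dn/\log(8dn/\mu)},$$ where the constant $C_2$, independent of $n$, is $$C_2=\frac{2K}{\mu}\left\{\frac{2}{(1-e^{-\pi\mu e/4})\left\{\cos\left(\frac{\pi}{2}\sin d\right)\right\}^{(\alpha+\beta)/2}\cos d}+e^{\pi\nu/4}\right\}.$$ -/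

import Mathlib

namespace SincQuad

noncomputable section

/-- The open strip `{ζ : |Im ζ| < d}`. -/
def strip (d : ℝ) : Set ℂ := {ζ : ℂ | |ζ.im| < d}

/-- The double-exponential map `ψ(t) = exp((π/2) sinh t)`, on the complex plane. -/
def psi (t : ℂ) : ℂ := Complex.exp ((Real.pi / 2 : ℂ) * Complex.sinh t)

/-- `E₂(z; α, β) = z^(α-1) / (1+z²)^((α+β)/2)`. The powers are principal values; only the modulus
of `E₂` is used below, and this does not depend on the branch, as the exponents are real. -/
def E2 (z : ℂ) (α β : ℝ) : ℂ :=
  z ^ ((α - 1 : ℝ) : ℂ) / (1 + z ^ 2) ^ (((α + β) / 2 : ℝ) : ℂ)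

/-- The mesh size `h = log(8dn/μ)/n`. -/
def mesh (d μ : ℝ) (n : ℕ) : ℝ := Real.log (8 * d * n / μ) / n

/-- The number `M` of nodes on the negative side. -/
def nodesM (α β h : ℝ) (n : ℕ) : ℤ :=
  if min α β = α then (n : ℤ) else (n : ℤ) - ⌊Real.log (α / β) / h⌋

/-- The number `N` of nodes on the positive side. -/
def nodesN (α β h : ℝ) (n : ℕ) : ℤ :=
  if min α β = α then (n : ℤ) - ⌊Real.log (β / α) / h⌋ else (n : ℤ)

/-- The threshold `x_γ`, for `γ > 0`. -/
def xThreshold (γ : ℝ) : ℝ :=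
  if γ < 1 / (2 * Real.pi) then
    Real.arsinh (√(1 + √(1 - (2 * Real.pi * γ) ^ 2)) / (2 * Real.pi * γ))
  else Real.arsinh 1

/-- The explicit constant `C₂`; it does not depend on `n`. -/
def constC2 (K α β d : ℝ) : ℝ :=
  2 * K / min α β *
    (2 / ((1 - Real.exp (-(Real.pi * min α β * Real.exp 1 / 4))) *
          Real.cos (Real.pi / 2 * Real.sin d) ^ ((α + β) / 2) * Real.cos d)
      + Real.exp (Real.pi * max α β / 4))

end

end SincQuad

/-! Substituting t = `psi` x turns the integral into one over ℝ of F(x) = f(`psi` x) `psi`'(x). The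
error of the truncated trapezoidal sum splits into a discretization and a truncation part.

Discretization: F is analytic in the strip and dominated there by a double exponential in |Re ζ|.
Moving the contour towards the edge makes its Fourier transform decay like exp(-2πd|ξ|), and Poisson
summation reduces the error to two geometric series (`norm_integral_sub_tsum_le`). The delicate
point is to keep 1 + `psi`² = 2 `psi` cosh((π/2) sinh ζ) away from zero:
`cosh_mul_cos_le_norm_cosh`, the source of the power of cos((π/2) sin d) in the constant.

Truncation: on the real line F is at most K times an `envelope` with an explicit antiderivative, and
each tail is a right Riemann sum. If the envelope decreases beyond the cut x₀, the antiderivative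
bounds the tail. If x₀ comes before the maximum point p, an extra (p - x₀) times the maximum is
paid; the threshold on x₀ keeps this within the same final bound (`tail_sum_le`, `peak_bound`).

Balance: with T = 8dn, the node numbers place the cuts at or beyond log(T/α) and log(T/β). Since x /
log x increases from e on, both tails then decay at the discretization rate (`le_mul_exp_div`). -/

namespace SincQuad

open Complex MeasureTheory Filter Topology Set Asymptotics
open scoped FourierTransform

/-! ### Trapezoidal rule for functions analytic in a strip -/

section StripQuadrature

variable {D : ℝ} {φ : ℂ → ℂ} {B : ℝ → ℝ}

lemma mem_strip_iff (x y D : ℝ) : ((x : ℂ) + y * I) ∈ strip D ↔ |y| < D := by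
  simp [strip]

lemma isOpen_strip (D : ℝ) : IsOpen (strip D) :=
  isOpen_lt (continuous_abs.comp Complex.continuous_im) continuous_const

lemma continuous_horizontal (hφ : DifferentiableOn ℂ φ (strip D)) {c : ℝ} (hc : |c| < D) :
    Continuous fun x : ℝ => φ (x + c * I) := by
  refine continuous_iff_continuousAt.2 fun x => ?_
  have h1 : ContinuousAt φ ((x : ℂ) + c * I) :=
    ((hφ.differentiableAt ((isOpen_strip D).mem_nhds ((mem_strip_iff x c D).2 hc)))).continuousAt
  exact ContinuousAt.comp (f := fun x : ℝ => (x : ℂ) + c * I) h1 (by fun_prop)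

lemma integrable_horizontal (hφ : DifferentiableOn ℂ φ (strip D)) (hB : Integrable B)
    (hφB : ∀ x y : ℝ, |y| < D → ‖φ (x + y * I)‖ ≤ B x) {c : ℝ} (hc : |c| < D) :
    Integrable fun x : ℝ => φ (x + c * I) :=
  hB.mono' (continuous_horizontal hφ hc).aestronglyMeasurable
    (Eventually.of_forall fun x => hφB x c hc)

lemma tendsto_vertical_integral_zero {l : Filter ℝ} (hB0 : Tendsto B l (𝓝 0))
    (hφB : ∀ x y : ℝ, |y| < D → ‖φ (x + y * I)‖ ≤ B x) {c : ℝ} (hc : |c| < D) :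
    Tendsto (fun T : ℝ => ∫ y in (0 : ℝ)..c, φ (T + y * I)) l (𝓝 0) := by
  refine squeeze_zero_norm (a := fun T => B T * |c - 0|) (fun T => ?_) ?_
  · refine intervalIntegral.norm_integral_le_of_norm_le_const fun y hy => hφB T y ?_
    have : |y| ≤ |c| := by
      rcases le_total 0 c with h | h
      · rw [uIoc_of_le h] at hy
        rw [abs_of_nonneg h, abs_of_pos hy.1]; exact hy.2
      · rw [uIoc_of_ge h] at hy
        rw [abs_of_nonpos h, abs_of_nonpos hy.2]; linarith [hy.1]
    exact this.trans_lt hc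
  · simpa using hB0.mul_const |c - 0|

/-- Shift of the path of integration inside a strip. -/
lemma integral_horizontal_eq (hφ : DifferentiableOn ℂ φ (strip D)) (hB : Integrable B)
    (hBtop : Tendsto B atTop (𝓝 0)) (hBbot : Tendsto B atBot (𝓝 0))
    (hφB : ∀ x y : ℝ, |y| < D → ‖φ (x + y * I)‖ ≤ B x) {c : ℝ} (hc : |c| < D) :
    ∫ x : ℝ, φ x = ∫ x : ℝ, φ (x + c * I) := by
  have h0 : |(0 : ℝ)| < D := by simpa using (abs_nonneg c).trans_lt hc
  have hrect (T : ℝ) : (∫ x in (-T)..T, φ (x + (0 : ℝ) * I)) - (∫ x in (-T)..T, φ (x + c * I))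
      + I * (∫ y in (0 : ℝ)..c, φ (T + y * I))
      - I * (∫ y in (0 : ℝ)..c, φ ((-T : ℝ) + y * I)) = 0 := by
    have := Complex.integral_boundary_rect_eq_zero_of_differentiableOn φ (-T : ℝ)
      ((T : ℂ) + c * I) (hφ.mono ?_)
    · simpa using this
    · intro z hz
      rw [mem_reProdIm] at hz
      have hz2 := hz.2
      simp only [ofReal_im, add_im, mul_im, ofReal_re, I_im, mul_one, I_re, mul_zero, add_zero,
        zero_add] at hz2
      have : |z.im| ≤ |c| := by
        rcases le_total 0 c with h | h
        · rw [uIcc_of_le h] at hz2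
          rw [abs_of_nonneg h, abs_of_nonneg hz2.1]; exact hz2.2
        · rw [uIcc_of_ge h] at hz2
          rw [abs_of_nonpos h, abs_of_nonpos hz2.2]; linarith [hz2.1]
      exact this.trans_lt hc
  have l1 := intervalIntegral_tendsto_integral (integrable_horizontal hφ hB hφB h0)
    tendsto_neg_atTop_atBot tendsto_id
  have l2 := intervalIntegral_tendsto_integral (integrable_horizontal hφ hB hφB hc)
    tendsto_neg_atTop_atBot tendsto_id
  have l3 := tendsto_vertical_integral_zero hBtop hφB hc
  have l4 := (tendsto_vertical_integral_zero hBbot hφB hc).comp tendsto_neg_atTop_atBot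
  have l := ((l1.sub l2).add (l3.const_mul I)).sub (l4.const_mul I)
  have := tendsto_nhds_unique (l.congr fun T => hrect T) tendsto_const_nhds
  simp only [mul_zero, add_zero, sub_zero] at this
  simpa using sub_eq_zero.1 this

lemma norm_exp_horizontal (ξ x y : ℝ) :
    ‖cexp (-2 * Real.pi * ξ * (x + y * I) * I)‖ = Real.exp (2 * Real.pi * ξ * y) := by
  rw [Complex.norm_exp]
  congr 1
  simp

/-- Exponential decay of the Fourier transform of a function that is analytic in a strip. -/
lemma norm_fourier_le (hD : 0 < D) (hφ : DifferentiableOn ℂ φ (strip D)) (hB : Integrable B)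
    (hBtop : Tendsto B atTop (𝓝 0)) (hBbot : Tendsto B atBot (𝓝 0))
    (hφB : ∀ x y : ℝ, |y| < D → ‖φ (x + y * I)‖ ≤ B x) (ξ : ℝ) :
    ‖𝓕 (fun x : ℝ => φ x) ξ‖ ≤ (∫ x, B x) * Real.exp (-(2 * Real.pi * D * |ξ|)) := by
  have key (c : ℝ) (hc : |c| < D) :
      ‖𝓕 (fun x : ℝ => φ x) ξ‖ ≤ (∫ x, B x) * Real.exp (2 * Real.pi * ξ * c) := by
    have h1 : 𝓕 (fun x : ℝ => φ x) ξ =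
        ∫ x : ℝ, (fun z : ℂ => cexp (-2 * Real.pi * ξ * z * I) * φ z) x := by
      rw [Real.fourier_real_eq_integral_exp_smul]
      congr 1 with x : 1
      rw [smul_eq_mul]
      congr 2
      push_cast
      ring
    have hbd (x y : ℝ) (hy : |y| < D) :
        ‖(fun z : ℂ => cexp (-2 * Real.pi * ξ * z * I) * φ z) (x + y * I)‖ ≤
          Real.exp (2 * Real.pi * |ξ| * D) * B x := by
      have hB0 : 0 ≤ B x := (norm_nonneg _).trans (hφB x y hy)
      rw [norm_mul, norm_exp_horizontal]
      refine mul_le_mul (Real.exp_le_exp.2 ?_) (hφB x y hy) (norm_nonneg _) (Real.exp_pos _).le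
      have : ξ * y ≤ |ξ| * D := (le_abs_self _).trans (by
        rw [abs_mul]; exact mul_le_mul_of_nonneg_left hy.le (abs_nonneg _))
      nlinarith [Real.pi_pos]
    have hd : DifferentiableOn ℂ (fun z : ℂ => cexp (-2 * Real.pi * ξ * z * I) * φ z) (strip D) :=
      DifferentiableOn.mul (by fun_prop) hφ
    rw [h1, integral_horizontal_eq hd (hB.const_mul _) (by simpa using hBtop.const_mul _)
      (by simpa using hBbot.const_mul _) hbd hc, mul_comm (∫ x, B x),
      ← integral_const_mul]
    refine norm_integral_le_of_norm_le (hB.const_mul _) (Eventually.of_forall fun x => ?_)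
    rw [norm_mul, norm_exp_horizontal]
    exact mul_le_mul_of_nonneg_left (hφB x c hc) (Real.exp_pos _).le
  have key2 (c : ℝ) (hc0 : 0 < c) (hc : c < D) :
      ‖𝓕 (fun x : ℝ => φ x) ξ‖ ≤ (∫ x, B x) * Real.exp (-(2 * Real.pi * c * |ξ|)) := by
    -- The contour moves to the side on which the Fourier kernel is small, opposite in sign to ξ.
    rcases le_total 0 ξ with h | h
    · convert key (-c) (by rwa [abs_neg, abs_of_pos hc0]) using 3
      rw [abs_of_nonneg h]; ring
    · convert key c (by rwa [abs_of_pos hc0]) using 3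
      rw [abs_of_nonpos h]; ring
  -- The majorant does not depend on c, so the edge c = D, outside the open strip, is reached as a
  -- limit.
  have hlim : Tendsto (fun c => (∫ x, B x) * Real.exp (-(2 * Real.pi * c * |ξ|))) (𝓝[<] D)
      (𝓝 ((∫ x, B x) * Real.exp (-(2 * Real.pi * D * |ξ|)))) :=
    (Continuous.tendsto (by fun_prop) D).mono_left nhdsWithin_le_nhds
  refine ge_of_tendsto hlim ?_
  filter_upwards [Ioo_mem_nhdsLT hD] with c hc using key2 c hc.1 hc.2

/-- Error of the unit-step trapezoidal rule for functions analytic in a strip. -/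
lemma norm_integral_sub_tsum_le (hD : 0 < D) (hφ : DifferentiableOn ℂ φ (strip D))
    (hB : Integrable B) (hBO : B =O[cocompact ℝ] fun x : ℝ => |x| ^ (-2 : ℝ))
    (hφB : ∀ x y : ℝ, |y| < D → ‖φ (x + y * I)‖ ≤ B x) :
    (Summable fun k : ℤ => φ k) ∧ ‖(∫ x : ℝ, φ x) - ∑' k : ℤ, φ k‖ ≤
      2 * (∫ x, B x) * (Real.exp (-(2 * Real.pi * D)) / (1 - Real.exp (-(2 * Real.pi * D)))) := by
  have h0 : |(0 : ℝ)| < D := by simpa using hD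
  have hlim : Tendsto (fun x : ℝ => |x| ^ (-2 : ℝ)) (cocompact ℝ) (𝓝 0) :=
    (tendsto_rpow_neg_atTop (by norm_num : (0 : ℝ) < 2)).comp tendsto_norm_cocompact_atTop
  have hB0 := hBO.trans_tendsto hlim
  rw [cocompact_eq_atBot_atTop, tendsto_sup] at hB0
  have hφB' (x : ℝ) : ‖φ x‖ ≤ B x := by simpa using hφB x 0 h0
  have hφO : (fun x : ℝ => φ x) =O[cocompact ℝ] fun x : ℝ => |x| ^ (-2 : ℝ) :=
    (IsBigO.of_bound 1 (Eventually.of_forall fun x => by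
      simpa using (hφB' x).trans (le_abs_self _))).trans hBO
  have hcont : Continuous fun x : ℝ => φ x := by simpa using continuous_horizontal hφ h0
  set r := Real.exp (-(2 * Real.pi * D)) with hr
  have hr0 : 0 < r := Real.exp_pos _
  have hr1 : r < 1 := Real.exp_lt_one_iff.2 (by have := mul_pos Real.pi_pos hD; linarith)
  set A := fun k : ℤ => 𝓕 (fun x : ℝ => φ x) (k : ℝ) with hA
  have hAle (k : ℤ) (m : ℕ) (hk : |(k : ℝ)| = m) : ‖A k‖ ≤ (∫ x, B x) * r ^ m := by
    have := norm_fourier_le hD hφ hB hB0.2 hB0.1 hφB (k : ℝ)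
    rwa [hk, show -(2 * Real.pi * D * (m : ℝ)) = m * (-(2 * Real.pi * D)) by ring,
      Real.exp_nat_mul] at this
  have hgeo1 : HasSum (fun m : ℕ => (∫ x, B x) * r ^ (m + 1)) ((∫ x, B x) * (r / (1 - r))) := by
    have := ((hasSum_geometric_of_lt_one hr0.le hr1).mul_right r).mul_left (∫ x, B x)
    rw [div_eq_mul_inv, mul_comm r]
    simpa only [pow_succ] using this
  have hp (m : ℕ) : ‖A (m + 1 : ℕ)‖ ≤ (∫ x, B x) * r ^ (m + 1) :=
    hAle _ _ (by rw [Int.cast_natCast, abs_of_nonneg (Nat.cast_nonneg _)])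
  have hneg (m : ℕ) : ‖A (-(m + 1 : ℕ))‖ ≤ (∫ x, B x) * r ^ (m + 1) :=
    hAle _ _ (by rw [Int.cast_neg, Int.cast_natCast, abs_neg, abs_of_nonneg (Nat.cast_nonneg _)])
  have s1 : Summable fun m : ℕ => A (m + 1 : ℕ) := .of_norm_bounded hgeo1.summable hp
  have s2 : Summable fun m : ℕ => A (-(m + 1 : ℕ)) := .of_norm_bounded hgeo1.summable hneg
  have s1' : Summable fun m : ℕ => A (m : ℕ) := (summable_nat_add_iff 1).1 s1
  have hsum : HasSum A ((∑' m : ℕ, A m) + ∑' m : ℕ, A (-(m + 1 : ℕ))) := by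
    refine HasSum.of_nat_of_neg_add_one s1'.hasSum ?_
    simpa using s2.hasSum
  -- Poisson summation; frequency 0 is the integral itself, so only nonzero frequencies contribute
  -- to the error.
  have hP := Real.tsum_eq_tsum_fourier_of_rpow_decay_of_summable hcont (by norm_num) hφO
    hsum.summable 0
  have hP' : ∑' k : ℤ, φ k = ∑' k : ℤ, A k := by simpa using hP
  have hA0 : A 0 = ∫ x : ℝ, φ x := by
    simp [hA, Real.fourier_real_eq_integral_exp_smul]
  have hsplit : ∑' m : ℕ, A m = A 0 + ∑' m : ℕ, A (m + 1 : ℕ) := by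
    simpa using s1'.tsum_eq_zero_add
  refine ⟨?_, ?_⟩
  · exact summable_of_isBigO (Real.summable_abs_int_rpow (by norm_num : (1 : ℝ) < 2))
      (hφO.comp_tendsto Int.tendsto_coe_cofinite)
  rw [hP', hsum.tsum_eq, hsplit, ← hA0]
  have e : A 0 - (A 0 + ∑' m : ℕ, A (m + 1 : ℕ) + ∑' m : ℕ, A (-(m + 1 : ℕ))) =
      -((∑' m : ℕ, A (m + 1 : ℕ)) + ∑' m : ℕ, A (-(m + 1 : ℕ))) := by ring
  rw [e, norm_neg]
  have b1 := tsum_of_norm_bounded hgeo1 hp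
  have b2 := tsum_of_norm_bounded hgeo1 hneg
  calc _ ≤ _ := norm_add_le _ _
    _ ≤ _ := add_le_add b1 b2
    _ = _ := by ring

end StripQuadrature

end SincQuad
namespace SincQuad

open Complex

/-! ### Bounds for the double-exponential map in the strip -/

section PsiBounds

lemma one_add_sq_half_le_cosh (a : ℝ) : 1 + a ^ 2 / 2 ≤ Real.cosh a := by
  have h1 : Real.cosh a = 1 + 2 * Real.sinh (a / 2) ^ 2 := by
    have := Real.cosh_two_mul (a / 2)
    rw [Real.cosh_sq, mul_div_cancel₀ a two_ne_zero] at this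
    linarith
  have h2 : (a / 2) ^ 2 ≤ Real.sinh (a / 2) ^ 2 := by
    rw [sq_le_sq, Real.abs_sinh]
    exact Real.self_le_sinh_iff.2 (abs_nonneg _)
  rw [h1]; linarith [h2, show (a / 2) ^ 2 = a ^ 2 / 4 by ring]

/-- With c = (π/2) sin y and s = cosh x, the sine of cs = c + c(s - 1) grows at most linearly in s -
1. The quadratic lower bound for cosh on the right grows at least as fast. -/
lemma abs_sin_mul_cosh_le (x : ℝ) {y : ℝ} (hy0 : 0 ≤ y) (hy : y ≤ Real.pi / 2) :
    |Real.sin (Real.pi / 2 * Real.cosh x * Real.sin y)| ≤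
      Real.cosh (Real.pi / 2 * Real.sinh x * Real.cos y) *
        Real.sin (Real.pi / 2 * Real.sin y) := by
  have hpi := Real.pi_pos
  set c := Real.pi / 2 * Real.sin y with hc
  have hs0 : 0 ≤ Real.sin y := Real.sin_nonneg_of_nonneg_of_le_pi hy0 (by linarith)
  have hc0 : 0 ≤ c := by positivity
  have hc1 : c ≤ Real.pi / 2 := by
    have := Real.sin_le_one y
    rw [hc]; nlinarith
  set s := Real.cosh x with hs
  have hs1 : 1 ≤ s := Real.one_le_cosh x
  have hsin : 2 / Real.pi * c ≤ Real.sin c := Real.mul_le_sin hc0 hc1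
  have hsin0 : 0 ≤ Real.sin c := le_trans (by positivity) hsin
  have hcos0 : 0 ≤ Real.cos c := Real.cos_nonneg_of_neg_pi_div_two_le_of_le (by linarith) hc1
  have hcos : Real.cos c ≤ Real.pi / 2 - c := by
    rw [← Real.sin_pi_div_two_sub]; exact Real.sin_le (by linarith)
  have hsin' : c ≤ Real.pi / 2 * Real.sin c := by
    have := mul_le_mul_of_nonneg_left hsin (by positivity : 0 ≤ Real.pi / 2)
    have e : Real.pi / 2 * (2 / Real.pi * c) = c := by field_simp
    linarith
  have h1 : |Real.sin (Real.pi / 2 * s * Real.sin y)| ≤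
      Real.sin c + Real.cos c * (c * (s - 1)) := by
    have e : Real.pi / 2 * s * Real.sin y = c + c * (s - 1) := by rw [hc]; ring
    rw [e, Real.sin_add]
    refine (abs_add_le _ _).trans (add_le_add ?_ ?_)
    · rw [abs_mul, abs_of_nonneg hsin0]
      exact mul_le_of_le_one_right hsin0 (Real.abs_cos_le_one _)
    · rw [abs_mul, abs_of_nonneg hcos0]
      refine mul_le_mul_of_nonneg_left (Real.abs_sin_le_abs.trans ?_) hcos0
      rw [abs_of_nonneg (mul_nonneg hc0 (by linarith))]
  -- Jordan's inequality sin c ≥ 2c/π and cos c ≤ π/2 - c compare the two slopes in s - 1.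
  have h2 : Real.cos c * c ≤ Real.sin c * (Real.pi ^ 2 / 4 - c ^ 2) := by
    calc Real.cos c * c ≤ (Real.pi / 2 - c) * (Real.pi / 2 * Real.sin c) :=
          mul_le_mul hcos hsin' hc0 (by linarith)
      _ ≤ Real.sin c * (Real.pi ^ 2 / 4 - c ^ 2) := by
          have : 0 ≤ Real.sin c * ((Real.pi / 2 - c) * c) :=
            mul_nonneg hsin0 (mul_nonneg (by linarith) hc0)
          linarith
  have hcy : Real.pi ^ 2 / 4 - c ^ 2 = Real.pi ^ 2 / 4 * Real.cos y ^ 2 := by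
    rw [hc, Real.cos_sq']; ring
  have h3 : 1 + (Real.pi ^ 2 / 4 - c ^ 2) * (s - 1) ≤
      Real.cosh (Real.pi / 2 * Real.sinh x * Real.cos y) := by
    refine le_trans ?_ (one_add_sq_half_le_cosh _)
    have e : (Real.pi / 2 * Real.sinh x * Real.cos y) ^ 2 =
        (Real.pi ^ 2 / 4 - c ^ 2) * (s ^ 2 - 1) := by
      rw [hcy, hs, Real.cosh_sq]; ring
    rw [e]
    have : 0 ≤ Real.pi ^ 2 / 4 - c ^ 2 := by rw [hcy]; positivity
    nlinarith [mul_nonneg this (sq_nonneg (s - 1))]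
  calc _ ≤ _ := h1
    _ ≤ (1 + (Real.pi ^ 2 / 4 - c ^ 2) * (s - 1)) * Real.sin c := by
        nlinarith [mul_le_mul_of_nonneg_right h2 (by linarith : 0 ≤ s - 1)]
    _ ≤ _ := mul_le_mul_of_nonneg_right h3 hsin0

lemma norm_cosh_add_mul_I_sq (a b : ℝ) :
    ‖Complex.cosh (a + b * I)‖ ^ 2 = Real.cosh a ^ 2 - Real.sin b ^ 2 := by
  rw [Complex.cosh_add, Complex.cosh_mul_I, Complex.sinh_mul_I, ← ofReal_cosh, ← ofReal_sinh,
    ← ofReal_cos, ← ofReal_sin, ← mul_assoc, ← ofReal_mul, ← ofReal_mul, ← normSq_eq_norm_sq,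
    normSq_add_mul_I]
  have := Real.sin_sq_add_cos_sq b
  rw [mul_pow, mul_pow, Real.cosh_sq]
  linear_combination (Real.sinh a ^ 2 + 1) * this

lemma norm_cosh_le (x y : ℝ) : ‖Complex.cosh (x + y * I)‖ ≤ Real.cosh x := by
  refine abs_le_of_sq_le_sq' ?_ (Real.cosh_pos x).le |>.2
  rw [norm_cosh_add_mul_I_sq]
  nlinarith [sq_nonneg (Real.sin y)]

/-- The exponent in `psi` splits into real and imaginary parts. -/
lemma half_pi_mul_sinh (x y : ℝ) : (Real.pi / 2 : ℂ) * Complex.sinh (x + y * I) =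
    ((Real.pi / 2 * Real.sinh x * Real.cos y : ℝ) : ℂ) +
      ((Real.pi / 2 * Real.cosh x * Real.sin y : ℝ) : ℂ) * I := by
  rw [Complex.sinh_add, Complex.cosh_mul_I, Complex.sinh_mul_I]
  push_cast
  ring

lemma cos_half_pi_sin_pos {y : ℝ} (hy : |y| < Real.pi / 2) :
    0 < Real.cos (Real.pi / 2 * Real.sin y) := by
  have hpi := Real.pi_pos
  obtain ⟨h1, h2⟩ := abs_lt.1 hy
  have hs1 : Real.sin y < 1 := by
    have := Real.sin_lt_sin_of_lt_of_le_pi_div_two h1.le le_rfl h2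
    rwa [Real.sin_pi_div_two] at this
  have hs2 : -1 < Real.sin y := by
    have := Real.sin_lt_sin_of_lt_of_le_pi_div_two le_rfl h2.le h1
    rwa [Real.sin_neg, Real.sin_pi_div_two] at this
  exact Real.cos_pos_of_mem_Ioo ⟨by nlinarith, by nlinarith⟩

/-- Since |cosh(a + ib)|² = cosh² a - sin² b, after squaring the claim is sin² b ≤ cosh² a ·
sin²((π/2) sin y), which is `abs_sin_mul_cosh_le` with the sign of y removed. -/
lemma cosh_mul_cos_le_norm_cosh (x : ℝ) {y : ℝ} (hy : |y| < Real.pi / 2) :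
    Real.cosh (Real.pi / 2 * Real.sinh x * Real.cos y) * Real.cos (Real.pi / 2 * Real.sin y) ≤
      ‖Complex.cosh ((Real.pi / 2 : ℂ) * Complex.sinh (x + y * I))‖ := by
  refine abs_le_of_sq_le_sq' ?_ (norm_nonneg _) |>.2
  rw [half_pi_mul_sinh, norm_cosh_add_mul_I_sq, mul_pow, Real.cos_sq']
  have key : Real.sin (Real.pi / 2 * Real.cosh x * Real.sin y) ^ 2 ≤
      (Real.cosh (Real.pi / 2 * Real.sinh x * Real.cos y) *
        Real.sin (Real.pi / 2 * Real.sin y)) ^ 2 := by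
    rcases le_total 0 y with h | h
    · rw [abs_of_nonneg h] at hy
      exact sq_le_sq.2 ((abs_sin_mul_cosh_le x h hy.le).trans (le_abs_self _))
    · rw [abs_of_nonpos h] at hy
      have := sq_le_sq.2 ((abs_sin_mul_cosh_le x (neg_nonneg.2 h) hy.le).trans (le_abs_self _))
      simpa only [Real.sin_neg, Real.cos_neg, mul_neg, neg_sq] using this
  rw [mul_pow] at key
  linarith

lemma hasDerivAt_psi (z : ℂ) :
    HasDerivAt psi (psi z * ((Real.pi / 2 : ℂ) * Complex.cosh z)) z :=
  ((Complex.hasDerivAt_sinh z).const_mul _).cexp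

lemma deriv_psi (z : ℂ) : deriv psi z = psi z * ((Real.pi / 2 : ℂ) * Complex.cosh z) :=
  (hasDerivAt_psi z).deriv

lemma norm_psi (x y : ℝ) :
    ‖psi (x + y * I)‖ = Real.exp (Real.pi / 2 * Real.sinh x * Real.cos y) := by
  rw [psi, half_pi_mul_sinh, Complex.norm_exp, add_re, re_ofReal_mul, ofReal_re, I_re, mul_zero,
    add_zero]

lemma le_norm_one_add_psi_sq (x : ℝ) {y : ℝ} (hy : |y| < Real.pi / 2) :
    (1 + Real.exp (Real.pi / 2 * Real.sinh x * Real.cos y) ^ 2) *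
      Real.cos (Real.pi / 2 * Real.sin y) ≤ ‖1 + psi (x + y * I) ^ 2‖ := by
  have e1 (w : ℂ) : 1 + cexp w ^ 2 = cexp w * (2 * Complex.cosh w) := by
    rw [Complex.two_cosh, mul_add, ← Complex.exp_add, ← Complex.exp_add, add_neg_cancel,
      Complex.exp_zero, sq, ← Complex.exp_add]
    ring
  have e2 (a : ℝ) : 1 + Real.exp a ^ 2 = Real.exp a * (2 * Real.cosh a) := by
    rw [Real.cosh_eq, mul_div_cancel₀ _ two_ne_zero, mul_add, ← Real.exp_add, ← Real.exp_add,
      add_neg_cancel, Real.exp_zero, sq, ← Real.exp_add]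
    ring
  have h := cosh_mul_cos_le_norm_cosh x hy
  rw [e2, psi, e1, norm_mul, ← psi, norm_psi, norm_mul]
  simp only [Complex.norm_ofNat]
  have := mul_le_mul_of_nonneg_left h
    (Real.exp_pos (Real.pi / 2 * Real.sinh x * Real.cos y)).le
  linarith

lemma norm_E2_mul_deriv_psi_le {α β : ℝ} (hα : 0 < α) (hβ : 0 < β) (x : ℝ) {y : ℝ}
    (hy : |y| < Real.pi / 2) :
    ‖E2 (psi (x + y * I)) α β‖ * ‖deriv psi (x + y * I)‖ ≤
      Real.pi / 2 * Real.cosh x * (Real.exp (α * (Real.pi / 2 * Real.sinh x * Real.cos y)) /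
        (1 + Real.exp (Real.pi / 2 * Real.sinh x * Real.cos y) ^ 2) ^ ((α + β) / 2)) /
        Real.cos (Real.pi / 2 * Real.sin y) ^ ((α + β) / 2) := by
  have hκ := cos_half_pi_sin_pos hy
  have hpi := Real.pi_pos
  have hab : 0 < (α + β) / 2 := by linarith
  have hle := le_norm_one_add_psi_sq x hy
  have hch := norm_cosh_le x y
  rw [E2, norm_div, Complex.norm_cpow_real, Complex.norm_cpow_real, deriv_psi, norm_mul, norm_psi]
  set a := Real.pi / 2 * Real.sinh x * Real.cos y
  set κ := Real.cos (Real.pi / 2 * Real.sin y)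
  -- The factor `psi` in `psi`' raises the exponent α - 1 to α.
  have e : Real.exp a ^ (α - 1) * Real.exp a = Real.exp (α * a) := by
    rw [← Real.exp_mul, ← Real.exp_add]; congr 1; ring
  have hp : 0 < 1 + Real.exp a ^ 2 := by positivity
  have hden : (1 + Real.exp a ^ 2) ^ ((α + β) / 2) * κ ^ ((α + β) / 2) ≤
      ‖1 + psi (x + y * I) ^ 2‖ ^ ((α + β) / 2) := by
    rw [← Real.mul_rpow hp.le hκ.le]
    exact Real.rpow_le_rpow (by positivity) hle hab.le
  have hden0 : 0 < (1 + Real.exp a ^ 2) ^ ((α + β) / 2) * κ ^ ((α + β) / 2) := by positivity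
  have hcosh : ‖(Real.pi / 2 : ℂ) * Complex.cosh (x + y * I)‖ ≤ Real.pi / 2 * Real.cosh x := by
    rw [norm_mul]
    refine mul_le_mul (le_of_eq ?_) hch (norm_nonneg _) (by positivity)
    simp [abs_of_pos hpi]
  calc _ = Real.exp (α * a) * ‖(Real.pi / 2 : ℂ) * Complex.cosh (x + y * I)‖ /
        ‖1 + psi (x + y * I) ^ 2‖ ^ ((α + β) / 2) := by rw [← e]; ring
    _ ≤ Real.exp (α * a) * (Real.pi / 2 * Real.cosh x) /
        ((1 + Real.exp a ^ 2) ^ ((α + β) / 2) * κ ^ ((α + β) / 2)) :=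
      div_le_div₀ (by positivity) (mul_le_mul_of_nonneg_left hcosh (Real.exp_pos _).le) hden0 hden
    _ = _ := by rw [← div_div]; ring

lemma exp_div_rpow_le_left {α β : ℝ} (hα : 0 < α) (hβ : 0 < β) (a : ℝ) :
    Real.exp (α * a) / (1 + Real.exp a ^ 2) ^ ((α + β) / 2) ≤ Real.exp (α * a) :=
  div_le_self (Real.exp_pos _).le
    (Real.one_le_rpow (by linarith [sq_nonneg (Real.exp a)]) (by linarith))

lemma exp_div_rpow_le_right {α β : ℝ} (hα : 0 < α) (hβ : 0 < β) (a : ℝ) :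
    Real.exp (α * a) / (1 + Real.exp a ^ 2) ^ ((α + β) / 2) ≤ Real.exp (-(β * a)) := by
  rw [div_le_iff₀ (by positivity)]
  have h1 : Real.exp ((α + β) * a) ≤ (1 + Real.exp a ^ 2) ^ ((α + β) / 2) := by
    have e : Real.exp ((α + β) * a) = (Real.exp a ^ 2) ^ ((α + β) / 2) := by
      rw [← Real.exp_nat_mul, ← Real.exp_mul]; congr 1; push_cast; ring
    rw [e]
    exact Real.rpow_le_rpow (by positivity) (by linarith) (by linarith)
  have := mul_le_mul_of_nonneg_left h1 (Real.exp_pos (-(β * a))).le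
  rwa [← Real.exp_add, show -(β * a) + (α + β) * a = α * a by ring] at this

end PsiBounds

end SincQuad
namespace SincQuad

open Set

/-! ### Tails of the trapezoidal sum -/

section Truncation

/-- A right Riemann sum is at most the corresponding integral of the monotone envelope, expressed
through an antiderivative `-Ψ` of the summand. -/
lemma sum_le_of_antitoneOn {G Ψ : ℝ → ℝ} {x₀ p h : ℝ} (hh : 0 < h) (hxp : x₀ ≤ p)
    (hΨ : ∀ x, HasDerivAt Ψ (-G x) x) (hΨ0 : ∀ x, 0 ≤ Ψ x) (hG0 : ∀ x, 0 ≤ G x)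
    (hanti : AntitoneOn G (Ici p)) (hle : ∀ x ∈ Icc x₀ p, G x ≤ G p) (m : ℕ) :
    ∑ j ∈ Finset.range m, h * G (x₀ + (j + 1) * h) ≤ Ψ p + (p - x₀) * G p := by
  have step (a b : ℝ) (ha : p ≤ a) (hab : a ≤ b) : (b - a) * G b ≤ Ψ a - Ψ b := by
    rcases hab.eq_or_lt with rfl | hlt
    · simp
    obtain ⟨c, hc, hc'⟩ := exists_hasDerivAt_eq_slope Ψ (fun x => -G x) hlt
      (fun x _ => (hΨ x).continuousAt.continuousWithinAt) (fun x _ => hΨ x)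
    have hba : 0 < b - a := sub_pos.2 hlt
    rw [eq_div_iff hba.ne'] at hc'
    have := hanti (show c ∈ Ici p from ha.trans hc.1.le) (show b ∈ Ici p from ha.trans hab) hc.2.le
    nlinarith
  -- Φ is an antiderivative of minus the envelope flattened to the constant G p before p; that
  -- function is antitone from x₀ on, so the sum telescopes.
  set Φ : ℝ → ℝ := fun x => Ψ (max x p) + (max x p - x) * G p with hΦ
  have hstep (a b : ℝ) (ha : x₀ ≤ a) (hab : a ≤ b) : (b - a) * G b ≤ Φ a - Φ b := by
    simp only [hΦ]
    rcases le_total p a with hpa | hpa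
    · rw [max_eq_left hpa, max_eq_left (hpa.trans hab)]
      linarith [step a b hpa hab]
    · rw [max_eq_right hpa]
      rcases le_total b p with hbp | hbp
      · rw [max_eq_right hbp]
        have := hle b ⟨ha.trans hab, hbp⟩
        nlinarith
      · rw [max_eq_left hbp]
        have h1 := step p b le_rfl hbp
        have h2 := hanti (show p ∈ Ici p from le_refl p) (show b ∈ Ici p from hbp) hbp
        nlinarith
  have htel : ∑ j ∈ Finset.range m, h * G (x₀ + (j + 1) * h) ≤ Φ x₀ - Φ (x₀ + m * h) := by
    induction m with
    | zero => simp
    | succ k ih =>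
      rw [Finset.sum_range_succ]
      have := hstep (x₀ + k * h) (x₀ + (k + 1) * h) (by
        have : 0 ≤ (k : ℝ) * h := by positivity
        linarith) (by linarith)
      push_cast
      rw [show x₀ + (k + 1) * h - (x₀ + k * h) = h by ring] at this
      linarith
  have hend : 0 ≤ Φ (x₀ + m * h) :=
    add_nonneg (hΨ0 _) (mul_nonneg (sub_nonneg.2 (le_max_left _ _)) (hG0 _))
  have h0 : Φ x₀ = Ψ p + (p - x₀) * G p := by simp only [hΦ, max_eq_right hxp]
  linarith

/-- The double-exponentially decaying envelope of the transformed integrand. -/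
noncomputable def envelope (c x : ℝ) : ℝ :=
  Real.pi / 2 * Real.cosh x * Real.exp (-(Real.pi / 2 * c * Real.sinh x))

lemma envelope_nonneg (c x : ℝ) : 0 ≤ envelope c x := by
  have := Real.cosh_pos x
  have := Real.pi_pos
  unfold envelope; positivity

lemma hasDerivAt_exp_neg_sinh {c : ℝ} (hc : 0 < c) (x : ℝ) :
    HasDerivAt (fun x => 1 / c * Real.exp (-(Real.pi / 2 * c * Real.sinh x)))
      (-envelope c x) x := by
  refine (((((Real.hasDerivAt_sinh x).const_mul (Real.pi / 2 * c)).fun_neg).exp).const_mul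
    (1 / c)).congr_deriv ?_
  unfold envelope
  field_simp

lemma hasDerivAt_envelope (c x : ℝ) :
    HasDerivAt (envelope c) (Real.pi / 2 * Real.exp (-(Real.pi / 2 * c * Real.sinh x)) *
      (Real.sinh x - Real.pi * c / 2 * (1 + Real.sinh x ^ 2))) x := by
  have := ((Real.hasDerivAt_cosh x).const_mul (Real.pi / 2)).mul
    ((((Real.hasDerivAt_sinh x).const_mul (Real.pi / 2 * c)).fun_neg).exp)
  refine this.congr_deriv ?_
  rw [show 1 + Real.sinh x ^ 2 = Real.cosh x ^ 2 by rw [Real.cosh_sq]; ring]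
  ring

lemma continuous_envelope (c : ℝ) : Continuous (envelope c) :=
  continuous_iff_continuousAt.2 fun x => (hasDerivAt_envelope c x).continuousAt

/-- In s = sinh x the sign of the derivative is that of s - (πc/2)(1 + s²), so monotonicity is a
question about a quadratic. -/
lemma antitoneOn_envelope {c p : ℝ}
    (hp : ∀ s, Real.sinh p ≤ s → s ≤ Real.pi * c / 2 * (1 + s ^ 2)) :
    AntitoneOn (envelope c) (Ici p) := by
  refine antitoneOn_of_deriv_nonpos (convex_Ici p) (continuous_envelope c).continuousOn
    (fun x _ => (hasDerivAt_envelope c x).differentiableAt.differentiableWithinAt) fun x hx => ?_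
  rw [(hasDerivAt_envelope c x).deriv]
  rw [interior_Ici] at hx
  have := hp _ (Real.sinh_le_sinh.2 (le_of_lt hx))
  have hpi := Real.pi_pos
  exact mul_nonpos_of_nonneg_of_nonpos (by positivity) (by linarith)

lemma monotoneOn_envelope {c a p : ℝ}
    (hp : ∀ s, Real.sinh a ≤ s → s ≤ Real.sinh p → Real.pi * c / 2 * (1 + s ^ 2) ≤ s) :
    MonotoneOn (envelope c) (Icc a p) := by
  refine monotoneOn_of_deriv_nonneg (convex_Icc a p) (continuous_envelope c).continuousOn
    (fun x _ => (hasDerivAt_envelope c x).differentiableAt.differentiableWithinAt) fun x hx => ?_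
  rw [(hasDerivAt_envelope c x).deriv]
  rw [interior_Icc] at hx
  have := hp _ (Real.sinh_le_sinh.2 hx.1.le) (Real.sinh_le_sinh.2 hx.2.le)
  have hpi := Real.pi_pos
  exact mul_nonneg (by positivity) (by linarith)

lemma concave_quadratic_nonneg {A C lam a b r : ℝ} (hlam : 0 ≤ lam) (har : a ≤ r) (hrb : r ≤ b)
    (ha : 0 ≤ A * a - lam * a ^ 2 - C) (hb : 0 ≤ A * b - lam * b ^ 2 - C) :
    0 ≤ A * r - lam * r ^ 2 - C := by
  rcases har.eq_or_lt with rfl | h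
  · exact ha
  have hba : 0 < b - a := by linarith
  have e : (b - a) * (A * r - lam * r ^ 2 - C) = (b - r) * (A * a - lam * a ^ 2 - C) +
      (r - a) * (A * b - lam * b ^ 2 - C) + lam * (b - a) * ((r - a) * (b - r)) := by ring
  refine nonneg_of_mul_nonneg_right (a := b - a) ?_ hba
  rw [e]
  have h1 : 0 ≤ r - a := by linarith
  have h2 : 0 ≤ b - r := by linarith
  positivity

lemma exp_five_quarters_lt : Real.exp (5 / 4) < 7 / 2 := by
  have h1 : Real.exp (5 / 4) ^ 4 = Real.exp 1 ^ 5 := by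
    rw [← Real.exp_nat_mul, ← Real.exp_nat_mul]; norm_num
  have h2 : Real.exp 1 ^ 5 < 2.7182818286 ^ 5 :=
    pow_lt_pow_left₀ Real.exp_one_lt_d9 (Real.exp_pos 1).le (by norm_num)
  refine lt_of_pow_lt_pow_left₀ 4 (by norm_num) ?_
  rw [h1]
  exact h2.trans (by norm_num)

/-- Multiplied by r, the claim is the nonnegativity of a concave quadratic in r, so the endpoints √2
and 1 + y suffice, with 1/(2x₀) replaced by a larger constant `lam`. -/
lemma peak_inequality {y t r x₀ : ℝ} (hy : 0 < y) (ht : 0 < t) (hyt : y ^ 2 + t ^ 2 = 1)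
    (hty : t ≤ y) (hr : √2 ≤ r) (hr' : r ≤ 1 + y) (hx : 1 ≤ x₀) (hexp : Real.exp x₀ = r / t) :
    (1 + y) / r - 1 + r / (2 * x₀) ≤ y + t / 2 := by
  have h2 : √2 ^ 2 = 2 := Real.sq_sqrt (by norm_num)
  have h2l : 1.414 < √2 := Real.lt_sqrt_of_sq_lt (by norm_num)
  have h2u : √2 < 1.415 := by
    rw [Real.sqrt_lt' (by norm_num)]; norm_num
  have hr0 : 0 < r := by linarith
  have hx0 : 0 < x₀ := by linarith
  have hy1 : y < 1 := by nlinarith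
  have hsum : 1 ≤ y + t := by nlinarith
  have main (lam : ℝ) (hlam : 0 ≤ lam) (hxl : 1 / (2 * x₀) ≤ lam)
      (ha : 0 ≤ (1 + y + t / 2) * √2 - lam * √2 ^ 2 - (1 + y))
      (hb : 0 ≤ (1 + y + t / 2) * (1 + y) - lam * (1 + y) ^ 2 - (1 + y)) :
      (1 + y) / r - 1 + r / (2 * x₀) ≤ y + t / 2 := by
    have hQ := concave_quadratic_nonneg hlam hr hr' ha hb
    have h3 : r / (2 * x₀) ≤ lam * r := by
      rw [div_eq_mul_one_div, mul_comm]; exact mul_le_mul_of_nonneg_right hxl hr0.le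
    have h4 : (1 + y) / r ≤ 1 + y + t / 2 - lam * r := by
      rw [div_le_iff₀ hr0]; linarith
    linarith
  -- For t ≥ 2/5, x₀ ≥ 1 suffices and `lam` = 1/2. For smaller t, exp x₀ = r/t ≥ 5√2/2 > 7/2 forces
  -- x₀ ≥ 5/4, which allows `lam` = 2/5.
  rcases le_total (2 / 5) t with h | h
  · refine main (1 / 2) (by norm_num) ?_ ?_ ?_
    · rw [div_le_div_iff₀ (by positivity) (by norm_num)]; linarith
    · rw [h2]
      have hy2 : y ≤ 0.9166 := by nlinarith
      have ht2 : t ≤ 0.7072 := by nlinarith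
      -- chord of the circle between `t = 2/5` and `t = y`
      have : 1.3 ≤ y + t := by nlinarith
      nlinarith
    · nlinarith
  · have hx' : 5 / 4 ≤ x₀ := by
      have h5 : Real.exp (5 / 4) < Real.exp x₀ := by
        refine exp_five_quarters_lt.trans ?_
        rw [hexp, lt_div_iff₀ ht]
        linarith
      exact (Real.exp_lt_exp.1 h5).le
    have hy2 : 0.9 ≤ y := by nlinarith
    refine main (2 / 5) (by norm_num) ?_ ?_ ?_
    · rw [div_le_div_iff₀ (by positivity) (by norm_num)]; linarith
    · rw [h2]; nlinarith
    · nlinarith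

/-- Dividing exp x₀ by x₀ ≥ 1 only weakens the bound, but gives the form that also survives when the
cut lies before the peak. -/
lemma exp_neg_sinh_le {c x₀ : ℝ} (hc : 0 < c) (h1 : 1 ≤ x₀) :
    Real.exp (-(Real.pi / 2 * c * Real.sinh x₀)) ≤
      Real.exp (Real.pi * c / 4 - Real.pi * c / 4 * (Real.exp x₀ / x₀)) := by
  have hpc : 0 < Real.pi * c := mul_pos Real.pi_pos hc
  have h2 : Real.exp x₀ / x₀ ≤ Real.exp x₀ := div_le_self (Real.exp_pos _).le h1
  have h3 : Real.exp (-x₀) ≤ 1 := Real.exp_le_one_iff.2 (by linarith)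
  rw [Real.exp_le_exp, Real.sinh_eq]
  nlinarith

/-- The bound at the maximum point `p` of the envelope, for a starting point `x₀` not far below. -/
lemma peak_bound {c q w x₀ p : ℝ} (hc : 0 < c) (hqdef : q = Real.pi * c) (hpc : 0 < q)
    (hw2 : w ^ 2 = 1 - q ^ 2) (hw0 : 0 < w) (h1 : 1 ≤ x₀)
    (hs0 : √(1 + w) ≤ q * Real.sinh x₀) (hsp : Real.sinh p = (1 + w) / q) (hxp : x₀ < p) :
    1 / c * Real.exp (-(Real.pi / 2 * c * Real.sinh p)) + (p - x₀) * envelope c p ≤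
      1 / c * Real.exp (q / 4 - q / 4 * (Real.exp x₀ / x₀)) := by
  -- Half-angle coordinates: if q = sin θ and w = cos θ, then y = cos(θ/2) and t = sin(θ/2).
  obtain ⟨y, hy⟩ : ∃ y, y = √((1 + w) / 2) := ⟨_, rfl⟩
  have hy2 : y ^ 2 = (1 + w) / 2 := by rw [hy]; exact Real.sq_sqrt (by linarith)
  have hy0 : 0 < y := by rw [hy]; exact Real.sqrt_pos.2 (by linarith)
  obtain ⟨t, ht⟩ : ∃ t, t = q / (2 * y) := ⟨_, rfl⟩
  have ht0 : 0 < t := by rw [ht]; positivity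
  have hqt : q = 2 * y * t := by rw [ht]; field_simp
  have hyt : y ^ 2 + t ^ 2 = 1 := by
    have e : 4 * y ^ 2 * (y ^ 2 + t ^ 2) = 4 * y ^ 2 := by
      have : 4 * y ^ 2 * (y ^ 2 + t ^ 2) = 4 * (y ^ 2) ^ 2 + q ^ 2 := by rw [hqt]; ring
      rw [this, hy2]; linear_combination hw2
    exact mul_left_cancel₀ (by positivity) (e.trans (mul_one _).symm)
  have hty : t ≤ y := by nlinarith
  have hcp : q * Real.cosh p = 2 * y := by
    refine (pow_left_inj₀ (by have := Real.cosh_pos p; positivity) (by positivity)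
      two_ne_zero).1 ?_
    rw [mul_pow, Real.cosh_sq, hsp]
    field_simp
    linear_combination hw2 - 4 * hy2
  have hep : q * Real.exp p = 2 * y * (1 + y) := by
    rw [← Real.sinh_add_cosh, mul_add, hcp, hsp, mul_div_cancel₀ _ hpc.ne']
    linear_combination -2 * hy2
  -- In this scale r = 1 + y corresponds to x₀ = p, and the threshold on x₀ gives r ≥ √2.
  obtain ⟨r, hr⟩ : ∃ r, r = t * Real.exp x₀ := ⟨_, rfl⟩
  have hr0 : 0 < r := by rw [hr]; positivity
  have hrlow : √2 ≤ r := by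
    have h3 : q * Real.exp x₀ = 2 * y * r := by rw [hqt, hr]; ring
    have h4 : 2 * √(1 + w) ≤ q * Real.exp x₀ := by
      rw [← Real.sinh_add_cosh]
      have := Real.sinh_lt_cosh x₀
      nlinarith
    have h5 : √(1 + w) = √2 * y := by
      rw [hy, ← Real.sqrt_mul (by norm_num)]; congr 1; ring
    rw [h5, h3] at h4
    nlinarith
  have hrp : r = (1 + y) * Real.exp (x₀ - p) := by
    rw [Real.exp_sub]
    have hpos := Real.exp_pos p
    field_simp
    have : 2 * y * (t * Real.exp p) = 2 * y * (1 + y) := by rw [← hep, hqt]; ring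
    have h3 : t * Real.exp p = 1 + y := mul_left_cancel₀ (by positivity) this
    rw [hr, ← h3]; ring
  have hrup : r ≤ 1 + y := by
    rw [hrp]
    exact mul_le_of_le_one_right (by positivity) (Real.exp_le_one_iff.2 (by linarith))
  have hδ : p - x₀ ≤ (1 + y) / r - 1 := by
    have : (1 + y) / r = Real.exp (p - x₀) := by
      rw [hrp, show p - x₀ = -(x₀ - p) by ring, Real.exp_neg]
      field_simp
    rw [this]
    linarith [Real.add_one_le_exp (p - x₀)]
  have hpeak := peak_inequality hy0 ht0 hyt hty hrlow hrup h1 (by rw [hr]; field_simp)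
  have hexpo : Real.pi / 2 * c * Real.sinh p = y ^ 2 := by
    rw [hsp, hy2, show Real.pi / 2 * c = q / 2 by rw [hqdef]; ring]
    field_simp
  have henv : envelope c p = 1 / c * (y * Real.exp (-(y ^ 2))) := by
    rw [envelope, hexpo]
    have : Real.pi / 2 * Real.cosh p = 1 / c * y := by
      rw [hqdef] at hcp
      field_simp
      linarith
    rw [this]; ring
  rw [henv, hexpo]
  have hfac : 1 / c * Real.exp (-(y ^ 2)) + (p - x₀) * (1 / c * (y * Real.exp (-(y ^ 2)))) =
      1 / c * (((p - x₀) * y + 1) * Real.exp (-(y ^ 2))) := by ring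
  rw [hfac]
  refine mul_le_mul_of_nonneg_left ?_ (by positivity)
  -- Bounding 1 + (p - x₀)y by an exponential leaves a comparison of exponents, which is y times
  -- `peak_inequality`.
  refine (mul_le_mul_of_nonneg_right (Real.add_one_le_exp ((p - x₀) * y))
    (Real.exp_pos _).le).trans ?_
  rw [← Real.exp_add, Real.exp_le_exp]
  have e : q / 4 * (Real.exp x₀ / x₀) = y * (r / (2 * x₀)) := by
    rw [hqt, hr]; field_simp; norm_num
  rw [e, show q / 4 = y * (t / 2) by rw [hqt]; ring]
  have := mul_le_mul_of_nonneg_left (hδ.trans (le_sub_iff_add_le.2 hpeak)) hy0.le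
  nlinarith

/-- For πc < 1 the envelope has a minimum and then a maximum, at sinh x = (1 ∓ w)/q with q = πc and
w = √(1 - q²). The threshold √(1 + w)/q lies between the two, so from x₀ on there is at most one
rise, up to p. -/
lemma tail_sum_le {c x₀ h : ℝ} (hc : 0 < c) (hh : 0 < h) (h1 : 1 ≤ x₀)
    (hx : xThreshold (c / 2) ≤ x₀) (m : ℕ) :
    ∑ j ∈ Finset.range m, h * envelope c (x₀ + (j + 1) * h) ≤
      1 / c * Real.exp (Real.pi * c / 4 - Real.pi * c / 4 * (Real.exp x₀ / x₀)) := by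
  have hpi := Real.pi_pos
  have hpc : 0 < Real.pi * c := mul_pos hpi hc
  have hΨ0 (x : ℝ) : 0 ≤ 1 / c * Real.exp (-(Real.pi / 2 * c * Real.sinh x)) := by positivity
  have beyond (hs : ∀ s, Real.sinh x₀ ≤ s → s ≤ Real.pi * c / 2 * (1 + s ^ 2)) :
      ∑ j ∈ Finset.range m, h * envelope c (x₀ + (j + 1) * h) ≤
        1 / c * Real.exp (Real.pi * c / 4 - Real.pi * c / 4 * (Real.exp x₀ / x₀)) := by
    have := sum_le_of_antitoneOn hh le_rfl (hasDerivAt_exp_neg_sinh hc) hΨ0 (envelope_nonneg c)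
      (antitoneOn_envelope hs) (fun x hx => (by rw [le_antisymm hx.2 hx.1])) m
    rw [sub_self, zero_mul, add_zero] at this
    exact this.trans (mul_le_mul_of_nonneg_left (exp_neg_sinh_le hc h1) (by positivity))
  rcases le_or_gt 1 (Real.pi * c) with hq | hq
  -- For πc ≥ 1 the quadratic has no sign change, and the envelope decreases everywhere.
  · exact beyond fun s _ => by nlinarith [sq_nonneg (s - 1)]
  obtain ⟨q, hqdef⟩ : ∃ q, q = Real.pi * c := ⟨_, rfl⟩
  rw [← hqdef] at hpc hq beyond ⊢
  have h2q : 2 * Real.pi * (c / 2) = q := by rw [hqdef]; ring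
  have hlt : c / 2 < 1 / (2 * Real.pi) := by
    rw [lt_div_iff₀ (by positivity)]; linarith
  rw [xThreshold, if_pos hlt, h2q] at hx
  obtain ⟨w, hw⟩ : ∃ w, w = √(1 - q ^ 2) := ⟨_, rfl⟩
  rw [← hw] at hx
  have hw2 : w ^ 2 = 1 - q ^ 2 := by rw [hw]; exact Real.sq_sqrt (by nlinarith)
  have hw0 : 0 < w := by rw [hw]; exact Real.sqrt_pos.2 (by nlinarith)
  have hw1 : w < 1 := by nlinarith
  have hs0 : √(1 + w) ≤ q * Real.sinh x₀ := by
    have := Real.sinh_le_sinh.2 hx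
    rw [Real.sinh_arsinh, div_le_iff₀ hpc] at this
    linarith
  have hroots (s : ℝ) : q / 2 * (1 + s ^ 2) - s =
      (q * s - (1 - w)) * (q * s - (1 + w)) / (2 * q) := by
    field_simp
    linear_combination hw2
  rcases le_or_gt (1 + w) (q * Real.sinh x₀) with hS | hS
  · refine beyond fun s hs => ?_
    have h3 : 1 + w ≤ q * s := hS.trans (mul_le_mul_of_nonneg_left hs hpc.le)
    have : 0 ≤ q / 2 * (1 + s ^ 2) - s := by
      rw [hroots]
      exact div_nonneg (mul_nonneg (by linarith) (by linarith)) (by linarith)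
    linarith
  -- `p` is the maximum point of the envelope
  obtain ⟨p, hsp⟩ : ∃ p, Real.sinh p = (1 + w) / q := ⟨_, Real.sinh_arsinh _⟩
  have hxp : x₀ < p := by
    rw [← Real.sinh_lt_sinh, hsp, lt_div_iff₀ hpc]; linarith
  have hsqrt1 : 1 ≤ √(1 + w) := Real.one_le_sqrt.2 (by linarith)
  have hanti : AntitoneOn (envelope c) (Ici p) := by
    refine antitoneOn_envelope fun s hs => ?_
    rw [← hqdef]
    rw [hsp, div_le_iff₀ hpc] at hs
    have : 0 ≤ q / 2 * (1 + s ^ 2) - s := by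
      rw [hroots]
      exact div_nonneg (mul_nonneg (by linarith) (by linarith)) (by linarith)
    linarith
  have hmono : MonotoneOn (envelope c) (Icc x₀ p) := by
    refine monotoneOn_envelope fun s hs hs' => ?_
    rw [← hqdef]
    rw [hsp, le_div_iff₀ hpc] at hs'
    have h3 : q * Real.sinh x₀ ≤ q * s := mul_le_mul_of_nonneg_left hs hpc.le
    have : q / 2 * (1 + s ^ 2) - s ≤ 0 := by
      rw [hroots]
      exact div_nonpos_of_nonpos_of_nonneg
        (mul_nonpos_of_nonneg_of_nonpos (by linarith) (by linarith)) (by linarith)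
    linarith
  refine (sum_le_of_antitoneOn hh hxp.le (hasDerivAt_exp_neg_sinh hc) hΨ0 (envelope_nonneg c)
    hanti (fun x hx => hmono hx ⟨hxp.le, le_rfl⟩ hx.2) m).trans ?_
  exact peak_bound hc hqdef hpc hw2 hw0 h1 hs0 hsp hxp

end Truncation

end SincQuad
namespace SincQuad

open Complex MeasureTheory Filter Topology Set Asymptotics

section Assembly

/-! Integrability and decay of the envelope -/

lemma tendsto_exp_neg_sinh {c : ℝ} (hc : 0 < c) :
    Tendsto (fun x => 1 / c * Real.exp (-(Real.pi / 2 * c * Real.sinh x))) atTop (𝓝 0) := by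
  have hsinh : Tendsto Real.sinh atTop atTop :=
    tendsto_atTop_mono' _ ((eventually_ge_atTop 0).mono fun x hx => Real.self_le_sinh_iff.2 hx)
      tendsto_id
  have h2 := Real.tendsto_exp_neg_atTop_nhds_zero.comp
    (hsinh.const_mul_atTop (by positivity : 0 < Real.pi / 2 * c))
  simpa using h2.const_mul (1 / c)

lemma integral_Ioi_envelope {c : ℝ} (hc : 0 < c) : ∫ x in Ioi 0, envelope c x = 1 / c := by
  rw [integral_Ioi_of_hasDerivAt_of_nonneg'
    (fun x _ => ((hasDerivAt_exp_neg_sinh hc x).fun_neg.congr_deriv (neg_neg _)))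
    (fun x _ => envelope_nonneg c x) (by simpa using (tendsto_exp_neg_sinh hc).neg)]
  simp

lemma integral_envelope_abs {c : ℝ} (hc : 0 < c) : ∫ x, envelope c |x| = 2 / c := by
  rw [integral_comp_abs, integral_Ioi_envelope hc]; ring

lemma integrable_envelope_abs {c : ℝ} (hc : 0 < c) : Integrable fun x => envelope c |x| := by
  -- A non-integrable function has integral 0 by convention, contradicting the value 2/c.
  by_contra h
  have h2 := integral_undef h
  rw [integral_envelope_abs hc] at h2
  have : 0 < 2 / c := by positivity
  linarith

lemma envelope_isBigO {c : ℝ} (hc : 0 < c) :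
    envelope c =O[atTop] fun x => x ^ (-2 : ℝ) := by
  have hpi := Real.pi_pos
  have hb : 0 < Real.pi / 2 * c := by positivity
  have hlo := (isLittleO_pow_exp_pos_mul_atTop 3 hb).bound (zero_lt_one)
  have hsinh : Tendsto Real.sinh atTop atTop :=
    tendsto_atTop_mono' _ ((eventually_ge_atTop 0).mono fun x hx => Real.self_le_sinh_iff.2 hx)
      tendsto_id
  refine IsBigO.of_bound (Real.pi) ?_
  filter_upwards [hsinh.eventually hlo, eventually_ge_atTop 1] with x hx hx1
  have hs : x ≤ Real.sinh x := Real.self_le_sinh_iff.2 (by linarith)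
  have hcosh : Real.cosh x ≤ 2 * Real.sinh x := by
    refine abs_le_of_sq_le_sq' ?_ (by linarith) |>.2
    rw [Real.cosh_sq]; nlinarith
  have hx0 : 0 < x := by linarith
  have hs0 : 0 < Real.sinh x := by linarith
  rw [Real.norm_of_nonneg (envelope_nonneg c x), Real.norm_of_nonneg (by positivity),
    show (-2 : ℝ) = -((2 : ℕ) : ℝ) by norm_num, Real.rpow_neg hx0.le, Real.rpow_natCast]
  rw [one_mul, Real.norm_of_nonneg (by positivity), Real.norm_of_nonneg (Real.exp_pos _).le] at hx
  rw [envelope, Real.exp_neg, ← div_eq_mul_inv, ← div_eq_mul_inv,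
    div_le_div_iff₀ (Real.exp_pos _) (by positivity)]
  calc Real.pi / 2 * Real.cosh x * x ^ 2
      ≤ Real.pi / 2 * (2 * Real.sinh x) * Real.sinh x ^ 2 := by gcongr
    _ = Real.pi * Real.sinh x ^ 3 := by ring
    _ ≤ _ := mul_le_mul_of_nonneg_left hx hpi.le

lemma envelope_abs_mul_isBigO {c h : ℝ} (hc : 0 < c) (hh : 0 < h) :
    (fun x => envelope c |x * h|) =O[cocompact ℝ] fun x : ℝ => |x| ^ (-2 : ℝ) := by
  have ht : Tendsto (fun x : ℝ => |x| * h) (cocompact ℝ) atTop :=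
    Tendsto.atTop_mul_const hh tendsto_norm_cocompact_atTop
  have h1 := (envelope_isBigO hc).comp_tendsto ht
  have e1 : (fun x => envelope c |x * h|) = envelope c ∘ fun x : ℝ => |x| * h := by
    ext x; simp [abs_mul, abs_of_pos hh]
  rw [e1]
  refine h1.trans (IsBigO.of_bound (h ^ (-2 : ℝ)) (Eventually.of_forall fun x => ?_))
  rw [Function.comp_apply, Real.mul_rpow (abs_nonneg x) hh.le, norm_mul, mul_comm,
    Real.norm_of_nonneg (by positivity : 0 ≤ h ^ (-2 : ℝ))]

/-! The transformed integrand -/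

/-- Decay comes from β on the right and α on the left; the smaller one, with cos y ≥ cos d, gives an
even majorant independent of y. -/
lemma norm_transform_le_envelope_abs {f : ℂ → ℂ} {d α β K : ℝ} (hd' : d < Real.pi / 2)
    (hα : 0 < α) (hβ : 0 < β) (hK : 0 < K)
    (hbound : ∀ z ∈ psi '' strip d, ‖f z‖ ≤ K * ‖E2 z α β‖) (x y : ℝ) (hy : |y| < d) :
    ‖f (psi (x + y * I)) * deriv psi (x + y * I)‖ ≤
      K / Real.cos (Real.pi / 2 * Real.sin d) ^ ((α + β) / 2) *
        envelope (min α β * Real.cos d) |x| := by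
  have hpi := Real.pi_pos
  have hd : 0 < d := (abs_nonneg y).trans_lt hy
  have hy2 : |y| < Real.pi / 2 := hy.trans hd'
  have hκd : 0 < Real.cos (Real.pi / 2 * Real.sin d) :=
    cos_half_pi_sin_pos (by rwa [abs_of_pos hd])
  have hcosd : 0 < Real.cos d := Real.cos_pos_of_mem_Ioo ⟨by linarith, hd'⟩
  have hcos : Real.cos d ≤ Real.cos y := by
    rw [← Real.cos_abs y]
    exact Real.cos_le_cos_of_nonneg_of_le_pi (abs_nonneg _) (by linarith) hy.le
  have hκ : Real.cos (Real.pi / 2 * Real.sin d) ≤ Real.cos (Real.pi / 2 * Real.sin y) := by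
    have e : Real.cos (Real.pi / 2 * Real.sin y) = Real.cos (Real.pi / 2 * Real.sin |y|) := by
      rcases abs_choice y with h | h <;> rw [h]
      rw [Real.sin_neg, mul_neg, Real.cos_neg]
    have h0 : 0 ≤ Real.sin |y| :=
      Real.sin_nonneg_of_nonneg_of_le_pi (abs_nonneg _) (by linarith)
    have h1 : Real.sin |y| ≤ Real.sin d :=
      Real.sin_le_sin_of_le_of_le_pi_div_two (by linarith [abs_nonneg y]) hd'.le hy.le
    have h2 := Real.sin_le_one d
    rw [e]
    exact Real.cos_le_cos_of_nonneg_of_le_pi (by positivity) (by nlinarith) (by gcongr)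
  have hμ : 0 < min α β := lt_min hα hβ
  have hX : Real.exp (α * (Real.pi / 2 * Real.sinh x * Real.cos y)) /
        (1 + Real.exp (Real.pi / 2 * Real.sinh x * Real.cos y) ^ 2) ^ ((α + β) / 2) ≤
      Real.exp (-(Real.pi / 2 * (min α β * Real.cos d) * Real.sinh |x|)) := by
    rcases le_total 0 x with hx | hx
    · refine (exp_div_rpow_le_right hα hβ _).trans (Real.exp_le_exp.2 (neg_le_neg ?_))
      have hs : 0 ≤ Real.sinh x := Real.sinh_nonneg_iff.2 hx
      have := mul_le_mul (min_le_right α β) hcos hcosd.le hβ.le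
      rw [abs_of_nonneg hx]
      have := mul_le_mul_of_nonneg_right this (by positivity : 0 ≤ Real.pi / 2 * Real.sinh x)
      linarith
    · refine (exp_div_rpow_le_left hα hβ _).trans (Real.exp_le_exp.2 ?_)
      have hs : Real.sinh x ≤ 0 := Real.sinh_nonpos_iff.2 hx
      have := mul_le_mul (min_le_left α β) hcos hcosd.le hα.le
      rw [abs_of_nonpos hx, Real.sinh_neg]
      have := mul_le_mul_of_nonneg_right this
        (mul_nonneg (by positivity : 0 ≤ Real.pi / 2) (neg_nonneg.2 hs))
      linarith
  have hE := norm_E2_mul_deriv_psi_le hα hβ x hy2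
  have hf := hbound _ ⟨_, (mem_strip_iff x y d).2 hy, rfl⟩
  have hcosh := Real.cosh_pos x
  calc ‖f (psi (x + y * I)) * deriv psi (x + y * I)‖
      ≤ K * (‖E2 (psi (x + y * I)) α β‖ * ‖deriv psi (x + y * I)‖) := by
        rw [norm_mul, ← mul_assoc]
        exact mul_le_mul_of_nonneg_right hf (norm_nonneg _)
    _ ≤ K * (Real.pi / 2 * Real.cosh x *
          Real.exp (-(Real.pi / 2 * (min α β * Real.cos d) * Real.sinh |x|)) /
        Real.cos (Real.pi / 2 * Real.sin d) ^ ((α + β) / 2)) := by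
        refine mul_le_mul_of_nonneg_left (hE.trans ?_) hK.le
        refine div_le_div₀ (by positivity) (mul_le_mul_of_nonneg_left hX (by positivity))
          (by positivity) ?_
        exact Real.rpow_le_rpow hκd.le hκ (by linarith)
    _ = _ := by rw [envelope, Real.cosh_abs]; ring

lemma norm_transform_ofReal_le {f : ℂ → ℂ} {d α β K : ℝ} (hd : 0 < d)
    (hα : 0 < α) (hβ : 0 < β) (hK : 0 < K)
    (hbound : ∀ z ∈ psi '' strip d, ‖f z‖ ≤ K * ‖E2 z α β‖) (x : ℝ) :
    ‖f (psi x) * deriv psi x‖ ≤ K * envelope β x ∧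
      ‖f (psi x) * deriv psi x‖ ≤ K * envelope α (-x) := by
  have hpi := Real.pi_pos
  have hE := norm_E2_mul_deriv_psi_le hα hβ x (y := 0) (by rw [abs_zero]; positivity)
  simp only [ofReal_zero, zero_mul, add_zero, Real.cos_zero, mul_one, Real.sin_zero, mul_zero,
    Real.one_rpow, div_one] at hE
  have hf := hbound (psi x) ⟨x, by simpa using (mem_strip_iff x 0 d).2 (by simpa using hd), rfl⟩
  have hcosh := Real.cosh_pos x
  have h1 : ‖f (psi x) * deriv psi x‖ ≤ K * (‖E2 (psi x) α β‖ * ‖deriv psi x‖) := by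
    rw [norm_mul, ← mul_assoc]
    exact mul_le_mul_of_nonneg_right hf (norm_nonneg _)
  refine ⟨h1.trans (mul_le_mul_of_nonneg_left (hE.trans ?_) hK.le),
    h1.trans (mul_le_mul_of_nonneg_left (hE.trans ?_) hK.le)⟩
  · rw [envelope]
    refine mul_le_mul_of_nonneg_left ((exp_div_rpow_le_right hα hβ _).trans_eq ?_) (by positivity)
    congr 1; ring
  -- The left tail is a right tail for -x, with decay governed by α.
  · rw [envelope, Real.cosh_neg, Real.sinh_neg]
    refine mul_le_mul_of_nonneg_left ((exp_div_rpow_le_left hα hβ _).trans_eq ?_) (by positivity)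
    congr 1; ring

lemma differentiableOn_transform {f : ℂ → ℂ} {d : ℝ}
    (hf : AnalyticOnNhd ℂ f (psi '' strip d)) :
    DifferentiableOn ℂ (fun z => f (psi z) * deriv psi z) (strip d) := by
  intro z hz
  have h1 : DifferentiableAt ℂ f (psi z) := (hf _ ⟨z, hz, rfl⟩).differentiableAt
  have h2 : DifferentiableAt ℂ psi z := (hasDerivAt_psi z).differentiableAt
  have h3 : DifferentiableAt ℂ (deriv psi) z := by
    have : deriv psi = fun z => psi z * ((Real.pi / 2 : ℂ) * Complex.cosh z) := funext deriv_psi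
    rw [this]
    exact h2.mul ((Complex.differentiable_cosh z).const_mul _)
  exact ((h1.comp z h2).mul h3).differentiableWithinAt

/-! Change of variables -/

lemma psi_ofReal (x : ℝ) : psi x = (Real.exp (Real.pi / 2 * Real.sinh x) : ℝ) := by
  rw [psi]; push_cast; rfl

lemma hasDerivAt_exp_half_pi_sinh (x : ℝ) :
    HasDerivAt (fun x => Real.exp (Real.pi / 2 * Real.sinh x))
      (Real.exp (Real.pi / 2 * Real.sinh x) * (Real.pi / 2 * Real.cosh x)) x :=
  ((Real.hasDerivAt_sinh x).const_mul _).exp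

lemma strictMono_exp_half_pi_sinh :
    StrictMono fun x => Real.exp (Real.pi / 2 * Real.sinh x) := by
  have := Real.pi_pos
  exact Real.exp_strictMono.comp (Real.sinh_strictMono.const_mul (by positivity))

lemma range_exp_half_pi_sinh :
    (fun x => Real.exp (Real.pi / 2 * Real.sinh x)) '' univ = Ioi 0 := by
  have := Real.pi_pos
  refine Subset.antisymm ?_ fun t ht => ?_
  · rintro _ ⟨x, -, rfl⟩
    exact Real.exp_pos _
  · refine ⟨Real.arsinh (2 / Real.pi * Real.log t), mem_univ _, ?_⟩
    have e : Real.pi / 2 * (2 / Real.pi * Real.log t) = Real.log t := by field_simp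
    simp only [Real.sinh_arsinh, e]
    exact Real.exp_log ht

lemma abs_deriv_smul_eq (f : ℂ → ℂ) (x : ℝ) :
    |Real.exp (Real.pi / 2 * Real.sinh x) * (Real.pi / 2 * Real.cosh x)| •
      f ((Real.exp (Real.pi / 2 * Real.sinh x) : ℝ) : ℂ) = f (psi x) * deriv psi x := by
  have := Real.pi_pos
  have := Real.cosh_pos x
  rw [abs_of_pos (by positivity), deriv_psi, psi_ofReal, mul_comm (f _), Complex.real_smul]
  push_cast
  rfl

lemma integrableOn_Ioi_iff_transform (f : ℂ → ℂ) :
    IntegrableOn (fun t : ℝ => f t) (Ioi 0) ↔ Integrable fun x : ℝ => f (psi x) * deriv psi x := by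
  rw [← range_exp_half_pi_sinh, integrableOn_image_iff_integrableOn_abs_deriv_smul
    MeasurableSet.univ (fun x _ => (hasDerivAt_exp_half_pi_sinh x).hasDerivWithinAt)
    strictMono_exp_half_pi_sinh.injective.injOn, integrableOn_univ]
  simp_rw [abs_deriv_smul_eq]

lemma integral_Ioi_eq_transform (f : ℂ → ℂ) :
    ∫ t in Ioi (0 : ℝ), f t = ∫ x : ℝ, f (psi x) * deriv psi x := by
  rw [← range_exp_half_pi_sinh, integral_image_eq_integral_abs_deriv_smul
    MeasurableSet.univ (fun x _ => (hasDerivAt_exp_half_pi_sinh x).hasDerivWithinAt)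
    strictMono_exp_half_pi_sinh.injective.injOn, setIntegral_univ]
  simp_rw [abs_deriv_smul_eq]

/-! Truncation of a bilateral series -/

/-- The window grows by one node at each end; `-M ≤ N + 1` keeps the two new nodes distinct and
outside the old window. -/
lemma norm_sum_Icc_sub_sum_Icc_le (φ : ℤ → ℂ) {M N : ℤ} (hMN : -M ≤ N + 1) (m : ℕ) :
    ‖∑ k ∈ Finset.Icc (-(M + m)) (N + m), φ k - ∑ k ∈ Finset.Icc (-M) N, φ k‖ ≤
      ∑ j ∈ Finset.range m, (‖φ (N + (j + 1))‖ + ‖φ (-(M + (j + 1)))‖) := by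
  induction m with
  | zero => simp
  | succ m ih =>
    have e : Finset.Icc (-(M + ((m + 1 : ℕ) : ℤ))) (N + ((m + 1 : ℕ) : ℤ)) =
        insert (N + ((m : ℤ) + 1)) (insert (-(M + ((m : ℤ) + 1)))
          (Finset.Icc (-(M + m)) (N + m))) := by
      ext k
      simp only [Finset.mem_Icc, Finset.mem_insert]
      omega
    rw [e, Finset.sum_insert, Finset.sum_insert, Finset.sum_range_succ]
    · have e2 (a b c s : ℂ) : a + (b + c) - s = (c - s) + (a + b) := by ring
      rw [e2]
      exact (norm_add_le _ _).trans (add_le_add ih (norm_add_le _ _))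
    · simp only [Finset.mem_Icc]; omega
    · simp only [Finset.mem_Icc, Finset.mem_insert]; omega

lemma norm_tsum_sub_sum_Icc_le {φ : ℤ → ℂ} (hφ : Summable φ) {M N : ℤ} (hMN : -M ≤ N + 1) {a : ℝ}
    (ha : ∀ m : ℕ, ∑ j ∈ Finset.range m, (‖φ (N + (j + 1))‖ + ‖φ (-(M + (j + 1)))‖) ≤ a) :
    ‖∑' k, φ k - ∑ k ∈ Finset.Icc (-M) N, φ k‖ ≤ a := by
  have ht : Tendsto (fun m : ℕ => Finset.Icc (-(M + m)) (N + m)) atTop atTop := by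
    refine tendsto_atTop_finset_of_monotone (fun i j hij => ?_) fun k => ?_
    · exact Finset.Icc_subset_Icc (by omega) (by omega)
    · refine ⟨(|k| + |M| + |N|).toNat, ?_⟩
      have h1 := abs_nonneg k
      have h2 := abs_nonneg M
      have h3 := abs_nonneg N
      have h4 := neg_abs_le k
      have h5 := le_abs_self k
      have h6 := neg_abs_le M
      have h7 := neg_abs_le N
      rw [Finset.mem_Icc, Int.toNat_of_nonneg (by omega)]
      omega
  exact le_of_tendsto ((hφ.hasSum.comp ht).sub_const _).norm
    (Eventually.of_forall fun m => (norm_sum_Icc_sub_sum_Icc_le φ hMN m).trans (ha m))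

/-! The numbers of nodes -/

lemma exp_mul_log_le {t : ℝ} (ht : 0 < t) : Real.exp 1 * Real.log t ≤ t := by
  have he := Real.exp_pos 1
  have := Real.log_le_sub_one_of_pos (div_pos ht he)
  rw [Real.log_div ht.ne' he.ne', Real.log_exp] at this
  have h2 : Real.log t ≤ t / Real.exp 1 := by linarith
  rwa [le_div_iff₀ he, mul_comm] at h2

/-- The function x / log x increases on [e, ∞), so exp x₀ ≥ T/c ≥ e bounds exp x₀ / x₀ below; then
log(T/c) ≤ log(T/μ). -/
lemma le_mul_exp_div {T μ c x₀ : ℝ} (hμ : 0 < μ) (hμc : μ ≤ c) (hT : c * Real.exp 1 ≤ T)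
    (hx : Real.log (T / c) ≤ x₀) :
    1 ≤ x₀ ∧ T / Real.log (T / μ) ≤ c * (Real.exp x₀ / x₀) := by
  have hc : 0 < c := hμ.trans_le hμc
  have hT0 : 0 < T := (by positivity : 0 < c * Real.exp 1).trans_le hT
  have hE0 : Real.exp 1 ≤ T / c := by rw [le_div_iff₀ hc]; linarith
  have hE0' : 0 < T / c := by positivity
  have hlog : 1 ≤ Real.log (T / c) := by rwa [Real.le_log_iff_exp_le hE0']
  have hE : T / c ≤ Real.exp x₀ := (Real.log_le_iff_le_exp hE0').1 hx
  have hx1 : 1 ≤ x₀ := hlog.trans hx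
  refine ⟨hx1, ?_⟩
  have hmono := Real.log_div_self_antitoneOn (show T / c ∈ {x | Real.exp 1 ≤ x} from hE0)
    (show Real.exp x₀ ∈ {x | Real.exp 1 ≤ x} from hE0.trans hE) hE
  simp only [Real.log_exp] at hmono
  have hlog2 : Real.log (T / c) ≤ Real.log (T / μ) :=
    Real.log_le_log hE0' (div_le_div_of_nonneg_left hT0.le hμ hμc)
  have h1 : T / c / Real.log (T / c) ≤ Real.exp x₀ / x₀ := by
    rw [div_le_div_iff₀ (by linarith) (by linarith)]
    rw [div_le_div_iff₀ (Real.exp_pos _) hE0'] at hmono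
    linarith
  calc T / Real.log (T / μ) ≤ T / Real.log (T / c) :=
        div_le_div_of_nonneg_left hT0.le (by linarith) hlog2
    _ = c * (T / c / Real.log (T / c)) := by field_simp
    _ ≤ _ := mul_le_mul_of_nonneg_left h1 hc.le

/-- The floor removes a length of at most log(b/a) from nh = log(T/a), leaving at least log(T/b). -/
lemma log_div_le_nodes {T a b h : ℝ} {n : ℕ} (hT : 0 < T) (ha : 0 < a) (hb : 0 < b) (hh : 0 < h)
    (hnh : n * h = Real.log (T / a)) :
    Real.log (T / b) ≤ (((n : ℤ) - ⌊Real.log (b / a) / h⌋ : ℤ) : ℝ) * h := by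
  have h1 := mul_le_mul_of_nonneg_right (Int.floor_le (Real.log (b / a) / h)) hh.le
  rw [div_mul_cancel₀ _ hh.ne', Real.log_div hb.ne' ha.ne'] at h1
  rw [Real.log_div hT.ne' ha.ne'] at hnh
  rw [Real.log_div hT.ne' hb.ne', Real.log_div hb.ne' ha.ne']
  push_cast
  linarith

lemma log_div_le_nodesM_and_nodesN {T α β h : ℝ} {n : ℕ} (hT : 0 < T) (hα : 0 < α) (hβ : 0 < β)
    (hh : 0 < h) (hnh : n * h = Real.log (T / min α β)) :
    Real.log (T / α) ≤ nodesM α β h n * h ∧ Real.log (T / β) ≤ nodesN α β h n * h := by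
  unfold nodesM nodesN
  split_ifs with hmin
  · rw [hmin] at hnh
    exact ⟨by rw [← hnh, Int.cast_natCast], log_div_le_nodes hT hα hβ hh hnh⟩
  · have hmin' : min α β = β := (min_choice α β).resolve_left hmin
    rw [hmin'] at hnh
    exact ⟨log_div_le_nodes hT hβ hα hh hnh, by rw [← hnh, Int.cast_natCast]⟩

end Assembly

end SincQuad
namespace SincQuad

open Complex MeasureTheory Filter Topology Set Asymptotics

/-! ### Discretization and truncation errors of the transformed integrand -/

section ErrorBounds

variable {f : ℂ → ℂ} {d α β K : ℝ}

/-- Discretization error of the trapezoidal rule applied to the transformed integrand. -/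
lemma discretization_error (hd : 0 < d) (hd' : d < Real.pi / 2) (hα : 0 < α) (hβ : 0 < β)
    (hK : 0 < K) (hf : AnalyticOnNhd ℂ f (psi '' strip d))
    (hbound : ∀ z ∈ psi '' strip d, ‖f z‖ ≤ K * ‖E2 z α β‖) {h : ℝ} (hh : 0 < h) :
    IntegrableOn (fun t : ℝ => f t) (Ioi 0) ∧
    (Summable fun k : ℤ => (h : ℂ) * (f (psi (k * h)) * deriv psi (k * h))) ∧
    ‖(∫ t in Ioi (0 : ℝ), f t) - ∑' k : ℤ, (h : ℂ) * (f (psi (k * h)) * deriv psi (k * h))‖ ≤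
      4 * K / (min α β * Real.cos d * Real.cos (Real.pi / 2 * Real.sin d) ^ ((α + β) / 2)) *
        (Real.exp (-(2 * Real.pi * (d / h))) / (1 - Real.exp (-(2 * Real.pi * (d / h))))) := by
  have hcosd : 0 < Real.cos d := Real.cos_pos_of_mem_Ioo ⟨by linarith, hd'⟩
  have hc : 0 < min α β * Real.cos d := mul_pos (lt_min hα hβ) hcosd
  have hκ : 0 < Real.cos (Real.pi / 2 * Real.sin d) ^ ((α + β) / 2) :=
    Real.rpow_pos_of_pos (cos_half_pi_sin_pos (by rwa [abs_of_pos hd])) _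
  set A := K / Real.cos (Real.pi / 2 * Real.sin d) ^ ((α + β) / 2) with hA
  set c := min α β * Real.cos d
  have hFB := fun x y hy => norm_transform_le_envelope_abs hd' hα hβ hK hbound x y hy
  have hdiff := differentiableOn_transform hf
  have hBint : Integrable fun x => A * envelope c |x| := (integrable_envelope_abs hc).const_mul A
  have hFint : Integrable fun x : ℝ => f (psi x) * deriv psi x := by
    have := integrable_horizontal hdiff hBint hFB (c := 0) (by simpa using hd)
    simpa using this
  -- Rescaling by h reduces to unit step, in a strip of half-width d/h.
  set φ : ℂ → ℂ := fun z => h * (f (psi (z * h)) * deriv psi (z * h)) with hφ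
  have hmap (x y : ℝ) (hy : |y| < d / h) : |y * h| < d := by
    rwa [abs_mul, abs_of_pos hh, ← lt_div_iff₀ hh]
  have hφdiff : DifferentiableOn ℂ φ (strip (d / h)) := by
    refine (DifferentiableOn.comp (g := fun z => f (psi z) * deriv psi z)
      (f := fun z : ℂ => z * h) hdiff (by fun_prop) fun z hz => ?_).const_mul _
    change |(z * h).im| < d
    rw [im_mul_ofReal]
    exact hmap 0 _ hz
  have hφB (x y : ℝ) (hy : |y| < d / h) : ‖φ (x + y * I)‖ ≤ h * (A * envelope c |x * h|) := by
    have e : ((x : ℂ) + y * I) * h = ((x * h : ℝ) : ℂ) + ((y * h : ℝ) : ℂ) * I := by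
      push_cast; ring
    simp only [hφ]
    rw [norm_mul, Complex.norm_real, Real.norm_of_nonneg hh.le, e]
    exact mul_le_mul_of_nonneg_left (hFB _ _ (hmap x y hy)) hh.le
  have hBhint : Integrable fun x => h * (A * envelope c |x * h|) :=
    (hBint.comp_mul_right' hh.ne').const_mul h
  have hBhO : (fun x => h * (A * envelope c |x * h|)) =O[cocompact ℝ]
      fun x : ℝ => |x| ^ (-2 : ℝ) :=
    ((envelope_abs_mul_isBigO hc hh).const_mul_left A).const_mul_left h
  obtain ⟨hsum, herr⟩ := norm_integral_sub_tsum_le (div_pos hd hh) hφdiff hBhint hBhO hφB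
  have hIB : ∫ x, h * (A * envelope c |x * h|) = A * (2 / c) := by
    rw [integral_const_mul, Measure.integral_comp_mul_right (fun x => A * envelope c |x|) h,
      integral_const_mul, integral_envelope_abs hc, abs_of_pos (inv_pos.2 hh), smul_eq_mul,
      ← mul_assoc, mul_inv_cancel₀ hh.ne', one_mul]
  have hIφ : ∫ x : ℝ, φ x = ∫ t in Ioi (0 : ℝ), f t := by
    have e (x : ℝ) : φ x = h * (fun x : ℝ => f (psi x) * deriv psi x) (x * h) := by
      simp [hφ]
    simp_rw [e]
    rw [integral_const_mul, Measure.integral_comp_mul_right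
      (fun x : ℝ => f (psi x) * deriv psi x) h, integral_Ioi_eq_transform,
      abs_of_pos (inv_pos.2 hh), Complex.real_smul, ← mul_assoc, ← ofReal_mul,
      mul_inv_cancel₀ hh.ne', ofReal_one, one_mul]
  refine ⟨(integrableOn_Ioi_iff_transform f).2 hFint, ?_, ?_⟩
  · simpa [hφ] using hsum
  · rw [hIB, hIφ] at herr
    have e : 2 * (A * (2 / c)) =
        4 * K / (c * Real.cos (Real.pi / 2 * Real.sin d) ^ ((α + β) / 2)) := by
      rw [hA]; field_simp; norm_num
    rw [e] at herr
    simpa [hφ] using herr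

/-- Truncation error of the bilateral series. -/
lemma truncation_error (hd : 0 < d) (hα : 0 < α) (hβ : 0 < β) (hK : 0 < K)
    (hbound : ∀ z ∈ psi '' strip d, ‖f z‖ ≤ K * ‖E2 z α β‖) {h : ℝ} (hh : 0 < h) {M N : ℤ}
    (hsum : Summable fun k : ℤ => (h : ℂ) * (f (psi (k * h)) * deriv psi (k * h)))
    (hM : 1 ≤ M * h) (hN : 1 ≤ N * h)
    (hMh : xThreshold (α / 2) ≤ M * h) (hNh : xThreshold (β / 2) ≤ N * h) :
    ‖∑' k : ℤ, (h : ℂ) * (f (psi (k * h)) * deriv psi (k * h)) -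
        ∑ k ∈ Finset.Icc (-M) N, (h : ℂ) * (f (psi (k * h)) * deriv psi (k * h))‖ ≤
      K * (1 / β * Real.exp (Real.pi * β / 4 - Real.pi * β / 4 * (Real.exp (N * h) / (N * h)))) +
      K * (1 / α *
        Real.exp (Real.pi * α / 4 - Real.pi * α / 4 * (Real.exp (M * h) / (M * h)))) := by
  have hM0 : 0 < M := by
    have : (0 : ℝ) < M := pos_of_mul_pos_left (by linarith) hh.le
    exact_mod_cast this
  have hN0 : 0 < N := by
    have : (0 : ℝ) < N := pos_of_mul_pos_left (by linarith) hh.le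
    exact_mod_cast this
  refine norm_tsum_sub_sum_Icc_le hsum (by omega) fun m => ?_
  have hterm (k : ℤ) : ‖(h : ℂ) * (f (psi (k * h)) * deriv psi (k * h))‖ ≤
      K * (h * envelope β (k * h)) ∧ ‖(h : ℂ) * (f (psi (k * h)) * deriv psi (k * h))‖ ≤
      K * (h * envelope α (-(k * h))) := by
    have := norm_transform_ofReal_le hd hα hβ hK hbound (k * h)
    push_cast at this
    rw [norm_mul, Complex.norm_real, Real.norm_of_nonneg hh.le, mul_left_comm K,
      mul_left_comm K]
    exact ⟨mul_le_mul_of_nonneg_left this.1 hh.le, mul_le_mul_of_nonneg_left this.2 hh.le⟩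
  rw [Finset.sum_add_distrib]
  refine add_le_add ?_ ?_
  · refine le_trans ?_ (mul_le_mul_of_nonneg_left (tail_sum_le hβ hh hN hNh m) hK.le)
    rw [Finset.mul_sum]
    refine Finset.sum_le_sum fun j _ => (hterm _).1.trans_eq ?_
    congr 3; push_cast; ring
  · refine le_trans ?_ (mul_le_mul_of_nonneg_left (tail_sum_le hα hh hM hMh m) hK.le)
    rw [Finset.mul_sum]
    refine Finset.sum_le_sum fun j _ => (hterm _).2.trans_eq ?_
    congr 3; push_cast; ring

end ErrorBounds

end SincQuad

/-! ### Balancing the two errors -/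

theorem theorem2p10 (d α β K : ℝ) (hd : 0 < d) (hd' : d < Real.pi / 2)
    (hα : 0 < α) (hβ : 0 < β) (hK : 0 < K)
    (f : ℂ → ℂ)
    (hf : AnalyticOnNhd ℂ f (SincQuad.psi '' SincQuad.strip d))
    (hbound : ∀ z ∈ SincQuad.psi '' SincQuad.strip d, ‖f z‖ ≤ K * ‖SincQuad.E2 z α β‖)
    (n : ℕ) (μ ν h : ℝ) (M N : ℤ)
    (hμ : μ = min α β) (hν : ν = max α β)
    (hh : h = SincQuad.mesh d μ n)
    (hM : M = SincQuad.nodesM α β h n) (hN : N = SincQuad.nodesN α β h n)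
    (hn : ν * Real.exp 1 / (8 * d) ≤ (n : ℝ))
    (hMh : SincQuad.xThreshold (α / 2) ≤ (M : ℝ) * h)
    (hNh : SincQuad.xThreshold (β / 2) ≤ (N : ℝ) * h) :
    MeasureTheory.IntegrableOn (fun t : ℝ => f (t : ℂ)) (Set.Ioi 0) ∧
    ‖(∫ t in Set.Ioi (0 : ℝ), f (t : ℂ))
        - (h : ℂ) * ∑ k ∈ Finset.Icc (-M) N,
            f (SincQuad.psi ((k : ℂ) * (h : ℂ))) * deriv SincQuad.psi ((k : ℂ) * (h : ℂ))‖
      ≤ SincQuad.constC2 K α β d *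
          Real.exp (-(2 * Real.pi * d * n / Real.log (8 * d * n / μ))) := by
  have hpi := Real.pi_pos
  have he := Real.exp_pos 1
  have hμ0 : 0 < μ := hμ ▸ lt_min hα hβ
  have hμα : μ ≤ α := hμ ▸ min_le_left α β
  have hμβ : μ ≤ β := hμ ▸ min_le_right α β
  have hαν : α ≤ ν := hν ▸ le_max_left α β
  have hβν : β ≤ ν := hν ▸ le_max_right α β
  have hν0 : 0 < ν := hα.trans_le hαν
  rw [div_le_iff₀ (by positivity)] at hn
  obtain ⟨T, hT⟩ : ∃ T, T = 8 * d * n := ⟨_, rfl⟩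
  have hTν : ν * Real.exp 1 ≤ T := by linarith
  have hT0 : 0 < T := (mul_pos hν0 he).trans_le hTν
  have hn0 : (0 : ℝ) < n := by
    by_contra hcon
    nlinarith
  have hTμ : Real.exp 1 ≤ T / μ := by
    rw [le_div_iff₀ hμ0]
    nlinarith [mul_le_mul_of_nonneg_right (hμα.trans hαν) he.le]
  have hlog : 1 ≤ Real.log (T / μ) := by rwa [Real.le_log_iff_exp_le (by positivity)]
  rw [SincQuad.mesh, ← hT] at hh
  rw [← hT]
  have hh0 : 0 < h := by rw [hh]; positivity
  have hnh : n * h = Real.log (T / μ) := by rw [hh]; field_simp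
  obtain ⟨hMlog, hNlog⟩ := SincQuad.log_div_le_nodesM_and_nodesN (n := n) hT0 hα hβ hh0 (hμ ▸ hnh)
  rw [← hM] at hMlog
  rw [← hN] at hNlog
  obtain ⟨hM1, hM2⟩ := SincQuad.le_mul_exp_div hμ0 hμα
    ((mul_le_mul_of_nonneg_right hαν he.le).trans hTν) hMlog
  obtain ⟨hN1, hN2⟩ := SincQuad.le_mul_exp_div hμ0 hμβ
    ((mul_le_mul_of_nonneg_right hβν he.le).trans hTν) hNlog
  obtain ⟨hint, hsum, hdisc⟩ := SincQuad.discretization_error hd hd' hα hβ hK hf hbound hh0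
  have htrunc := SincQuad.truncation_error hd hα hβ hK hbound hh0 hsum hM1 hN1 hMh hNh
  refine ⟨hint, ?_⟩
  have hexp : 2 * Real.pi * (d / h) = 2 * Real.pi * d * n / Real.log (T / μ) := by
    rw [← hnh]; field_simp
  -- The 8 in T = 8dn matches the tail factor π/4 to the discretization rate 2πd.
  have hexpT : 2 * Real.pi * d * n / Real.log (T / μ) =
      Real.pi / 4 * (T / Real.log (T / μ)) := by
    rw [hT]; ring
  rw [hexp] at hdisc
  obtain ⟨r, hr⟩ : ∃ r, r = Real.exp (-(2 * Real.pi * d * n / Real.log (T / μ))) := ⟨_, rfl⟩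
  rw [← hr] at hdisc ⊢
  have hr0 : 0 < r := hr ▸ Real.exp_pos _
  have hside (c x : ℝ) (hμc : μ ≤ c) (hcν : c ≤ ν)
      (hx : T / Real.log (T / μ) ≤ c * (Real.exp x / x)) :
      K * (1 / c * Real.exp (Real.pi * c / 4 - Real.pi * c / 4 * (Real.exp x / x))) ≤
        K / μ * Real.exp (Real.pi * ν / 4) * r := by
    rw [hr, hexpT, mul_assoc (K / μ), ← Real.exp_add, ← mul_assoc, mul_one_div]
    refine mul_le_mul (div_le_div_of_nonneg_left hK.le hμ0 hμc) (Real.exp_le_exp.2 ?_)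
      (Real.exp_pos _).le (by positivity)
    nlinarith
  -- From e log t ≤ t at t = T/μ; this makes the denominator 1 - r bounded below independently of n.
  have hrle : r ≤ Real.exp (-(Real.pi * μ * Real.exp 1 / 4)) := by
    rw [hr, hexpT, Real.exp_le_exp, neg_le_neg_iff]
    have h1 : μ * Real.exp 1 ≤ T / Real.log (T / μ) := by
      rw [le_div_iff₀ (by linarith)]
      have := SincQuad.exp_mul_log_le (div_pos hT0 hμ0)
      rw [le_div_iff₀ hμ0] at this
      linarith
    nlinarith
  obtain ⟨ρ, hρ⟩ : ∃ ρ, ρ = Real.exp (-(Real.pi * μ * Real.exp 1 / 4)) := ⟨_, rfl⟩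
  have hρ1 : ρ < 1 := by
    rw [hρ, Real.exp_lt_one_iff]
    have : 0 < Real.pi * μ * Real.exp 1 / 4 := by positivity
    linarith
  rw [← hρ] at hrle
  have hcosd : 0 < Real.cos d := Real.cos_pos_of_mem_Ioo ⟨by linarith, hd'⟩
  have hκ : 0 < Real.cos (Real.pi / 2 * Real.sin d) ^ ((α + β) / 2) :=
    Real.rpow_pos_of_pos (SincQuad.cos_half_pi_sin_pos (by rwa [abs_of_pos hd])) _
  rw [SincQuad.constC2, ← hμ, ← hν, ← hρ]
  rw [← hμ] at hdisc
  obtain ⟨κ, hκdef⟩ : ∃ κ, κ = Real.cos (Real.pi / 2 * Real.sin d) ^ ((α + β) / 2) := ⟨_, rfl⟩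
  rw [← hκdef] at hdisc hκ ⊢
  have hdisc' : 4 * K / (μ * Real.cos d * κ) * (r / (1 - r)) ≤
      2 * K / μ * (2 / ((1 - ρ) * κ * Real.cos d)) * r := by
    have h1 : r / (1 - r) ≤ r / (1 - ρ) :=
      div_le_div_of_nonneg_left hr0.le (by linarith) (by linarith)
    have hρ2 : 0 < 1 - ρ := by linarith
    refine (mul_le_mul_of_nonneg_left h1 (by positivity)).trans_eq ?_
    field_simp
    norm_num
  rw [Finset.mul_sum]
  calc _ ≤ _ := norm_sub_le_norm_sub_add_norm_sub _
        (∑' k : ℤ, (h : ℂ) * (f (SincQuad.psi (k * h)) * deriv SincQuad.psi (k * h))) _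
    _ ≤ _ := add_le_add (hdisc.trans hdisc')
        (htrunc.trans (add_le_add (hside β _ hμβ hβν hN2) (hside α _ hμα hαν hM2)))
    _ = _ := by ring
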